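/- There is a universal constant $C>0$ such that the following holds. Let $L\ge 1$, let $d_0,\dots,d_L$ and $m_1,\dots,m_L$ be dimensions, write $d=d_0$, $k=d_L\ge 2$, and $W=\max\{d_0,\dots,d_L,m_1,\dots,m_L\}$. Let $\sigma_i:\mathbb{R}^{m_i}\to\mathbb{R}^{d_i}$ be $\rho_i$-Lipschitz for the Euclidean norms with $\sigma_i(0)=0$, and let $M_i\in\mathbb{R}^{m_i\times d_{i-1}}$ be fixed reference matrices ($1\le i\le L$). For weights $\mathcal A=(A_1,\dots,A_L)$, $A_i\in\mathbb{R}^{m_i\times d_{i-1}}$, let $$F_{\mathcal A}(x)=\sigma_L(A_L\,\sigma_{L-1}(A_{L-1}\cdots\sigma_1(A_1x)\cdots)),\qquad x\in\mathbb{R}^d .$$ Write $\|\cdot\|_\sigma$ for the spectral norm, $\|B\|_{2,1}$ for the sum of the Euclidean norms of the columns of $B$, $a_i=\|A_i^\top-M_i^\top\|_{2,1}$, $s_i=\|A_i\|_\sigma$, and let $$R_{\mathcal A}=\Big(\prod_{i=1}^L\rho_i s_i\Big)\Big(\sum_{i=1}^L \frac{a_i^{2/3}}{s_i^{2/3}}\Big)^{3/2}$$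 be the spectral complexity. For $\gamma>0$ let $\ell_\gamma(r)=0$ for $r<-\gamma$, $\ell_\gamma(r)=1+r/\gamma$ for $-\gamma\le r\le 0$, $\ell_\gamma(r)=1$ for $r>0$. For a sample $((x_i,y_i))_{i=1}^n$ in $\mathbb{R}^d\times\{1,\dots,k\}$ put $\|X\|_2=(\sum_i\|x_i\|_2^2)^{1/2}$ and $$\widehat{\mathcal R}_\gamma(f)=\frac1n\sum_{i=1}^n\ell_\gamma\Big(\max_{j\ne y_i}f(x_i)_j-f(x_i)_{y_i}\Big).$$ Let $0<\delta<1$. (1) For every probability distribution on $\mathbb{R}^d\times\{1,\dots,k\}$ and every $n\ge 1$, with probability at least $1-\delta$ over an iid sample $((x_i,y_i))_{i=1}^n$, every $\gamma>0$ and every choice of weights $\mathcal A$ satisfy, for any rule of breaking ties in the $\arg\max$, $$\Pr\big[\arg\max_j F_{\mathcal A}(x)_j\ne y\big]\le\widehat{\mathcal R}_\gamma(F_{\mathcal A})+f(n,\gamma,X,\mathcal A),$$ where $(x,y)$ is a fresh draw and $$f=\frac8n+\frac{144\ln(n)\ln(2W)}{\gamma n}\Big(\prod_i\rho_i\Big)(1+\|X\|_2)\Big(\sum_{i=1}^L\Big(\big(\tfrac1L+a_i\big)\prod_{j\ne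 i}\big(\tfrac1L+s_j\big)\Big)^{2/3}\Big)^{3/2}$$ $$\qquad+\sqrt{\frac9{2n}}\sqrt{\ln\tfrac1\delta+\ln 2+\big|\ln\tfrac n\gamma\big|+2\ln(2+\|X\|_2)+2\sum_i\ln(2+La_i)+2\sum_i\ln(2+Ls_i)} .$$ (2) For every sample, every $\gamma>0$ and every $\mathcal A$, $$\widehat{\mathcal R}_\gamma(F_{\mathcal A})\le \frac1n\sum_{i=1}^n \mathbf 1\Big[F_{\mathcal A}(x_i)_{y_i}\le\gamma+\max_{j\ne y_i}F_{\mathcal A}(x_i)_j\Big].$$ (3) Suppose all $\rho_i>0$. Then $f=\widetilde{\mathcal O}(g)$, where $$g=\frac{\|X\|_2R_{\mathcal A}}{\gamma n}\ln(W)+\sqrt{\frac{\ln(1/\delta)}n},$$ in the following sense: with $L$, the dimensions, $\rho_i$, $M_i$ and $\delta$ fixed, along every sequence of tuples $(n,\gamma,X,\mathcal A)$ with $\gamma>0$, $n\to\infty$, $\|X\|_2\to\infty$ and $\|A_i\|_\sigma\to\infty$ for every $i$, one eventually has $$f\le C\,g\,\big(\ln n+|\ln\gamma|+\ln\|X\|_2+\ln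 R_{\mathcal A}\big).$$ -/

import Mathlib

open MeasureTheory Filter Topology

noncomputable section

namespace SpectralMargin

/-- Weight matrices of an `L`-layer network. Layer `i` multiplies by a matrix of size
`m i × d i.castSucc` and then applies a nonlinearity `ℝ^(m i) → ℝ^(d i.succ)`. -/
abbrev Weights {L : ℕ} (d : Fin (L + 1) → ℕ) (m : Fin L → ℕ) : Type :=
  ∀ i : Fin L, Matrix (Fin (m i)) (Fin (d i.castSucc)) ℝ

/-- Nonlinearities of an `L`-layer network, between Euclidean spaces. -/
abbrev Nonlinearities {L : ℕ} (d : Fin (L + 1) → ℕ) (m : Fin L → ℕ) : Type :=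
  ∀ i : Fin L, EuclideanSpace ℝ (Fin (m i)) → EuclideanSpace ℝ (Fin (d i.succ))

/-- The output of the first `i` layers on input `x`. -/
def layerOutput {L : ℕ} {d : Fin (L + 1) → ℕ} {m : Fin L → ℕ} (σ : Nonlinearities d m)
    (A : Weights d m) (x : EuclideanSpace ℝ (Fin (d 0))) :
    ∀ i : Fin (L + 1), EuclideanSpace ℝ (Fin (d i)) :=
  Fin.induction x (fun i z => σ i (WithLp.toLp 2 (Matrix.mulVec (A i) z)))

/-- The network `F_A(x) = σ_L (A_L σ_{L-1} (A_{L-1} ⋯ σ_1 (A_1 x) ⋯))`. -/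
def network {L : ℕ} {d : Fin (L + 1) → ℕ} {m : Fin L → ℕ} (σ : Nonlinearities d m)
    (A : Weights d m) (x : EuclideanSpace ℝ (Fin (d 0))) :
    EuclideanSpace ℝ (Fin (d (Fin.last L))) :=
  layerOutput σ A x (Fin.last L)

/-- The largest dimension of all the spaces that occur in the network. -/
def width {L : ℕ} (d : Fin (L + 1) → ℕ) (m : Fin L → ℕ) : ℕ :=
  max (Finset.univ.sup d) (Finset.univ.sup m)

open scoped Matrix.Norms.L2Operator in
/-- The spectral norm: the operator norm with respect to Euclidean norms. -/
def spectralNorm {p q : ℕ} (A : Matrix (Fin p) (Fin q) ℝ) : ℝ := ‖A‖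

/-- The `(2,1)` norm: the sum of the Euclidean norms of the columns. -/
def norm21 {p q : ℕ} (A : Matrix (Fin p) (Fin q) ℝ) : ℝ :=
  ∑ j, Real.sqrt (∑ i, A i j ^ 2)

/-- The entrywise `ℓ₂` norm of the matrix whose rows are the data points. -/
def dataNorm {n q : ℕ} (x : Fin n → EuclideanSpace ℝ (Fin q)) : ℝ :=
  Real.sqrt (∑ i, ‖x i‖ ^ 2)

/-- The margin operator `v_y - max_{j ≠ y} v_j` (used for at least two classes). -/
def margin {k : ℕ} (v : EuclideanSpace ℝ (Fin k)) (y : Fin k) : ℝ :=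
  v y - ⨆ j : {j : Fin k // j ≠ y}, v j

/-- The ramp loss. -/
def ramp (γ r : ℝ) : ℝ :=
  if r < -γ then 0 else if r ≤ 0 then 1 + r / γ else 1

/-- The empirical ramp risk of `f` on the sample `S`. -/
def empiricalRampRisk {n q k : ℕ} (γ : ℝ)
    (f : EuclideanSpace ℝ (Fin q) → EuclideanSpace ℝ (Fin k))
    (S : Fin n → EuclideanSpace ℝ (Fin q) × Fin k) : ℝ :=
  (n : ℝ)⁻¹ * ∑ i, ramp γ (-margin (f (S i).1) (S i).2)

open scoped Classical in
/-- The fraction of sample points with `f(x_i)_{y_i} ≤ γ + max_{j ≠ y_i} f(x_i)_j`. -/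
def empiricalMarginError {n q k : ℕ} (γ : ℝ)
    (f : EuclideanSpace ℝ (Fin q) → EuclideanSpace ℝ (Fin k))
    (S : Fin n → EuclideanSpace ℝ (Fin q) × Fin k) : ℝ :=
  (n : ℝ)⁻¹ * ∑ i, if f (S i).1 (S i).2 ≤ γ + ⨆ j : {j : Fin k // j ≠ (S i).2}, f (S i).1 j
    then 1 else 0

/-- The spectral complexity `R_A` relative to Lipschitz constants `ρ` and reference
matrices `M`. -/
def spectralComplexity {L : ℕ} {d : Fin (L + 1) → ℕ} {m : Fin L → ℕ} (ρ : Fin L → NNReal)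
    (M A : Weights d m) : ℝ :=
  (∏ i, (ρ i : ℝ) * spectralNorm (A i)) *
    (∑ i, norm21 ((A i).transpose - (M i).transpose) ^ (2 / 3 : ℝ) /
      spectralNorm (A i) ^ (2 / 3 : ℝ)) ^ (3 / 2 : ℝ)

/-- The explicit excess risk. `B` stands for the norm of the data. -/
def excess {L : ℕ} {d : Fin (L + 1) → ℕ} {m : Fin L → ℕ} (ρ : Fin L → NNReal)
    (M : Weights d m) (δ : ℝ) (n : ℕ) (γ B : ℝ) (A : Weights d m) : ℝ :=
  8 / n +
  144 * Real.log n * Real.log (2 * width d m) / (γ * n) * (∏ i, (ρ i : ℝ)) * (1 + B) *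
    (∑ i, ((1 / (L : ℝ) + norm21 ((A i).transpose - (M i).transpose)) *
      ∏ j ∈ Finset.univ.erase i, (1 / (L : ℝ) + spectralNorm (A j))) ^ (2 / 3 : ℝ)) ^
        (3 / 2 : ℝ) +
  Real.sqrt (9 / (2 * n)) *
    Real.sqrt (Real.log (1 / δ) + (Real.log 2 + |Real.log (n / γ)|) + 2 * Real.log (2 + B) +
      2 * ∑ i, Real.log (2 + L * norm21 ((A i).transpose - (M i).transpose)) +
      2 * ∑ i, Real.log (2 + L * spectralNorm (A i)))

/-- The leading-order rate `‖X‖₂ R_A ln(W) / (γ n) + √(ln(1/δ) / n)`. -/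
def rate {L : ℕ} {d : Fin (L + 1) → ℕ} {m : Fin L → ℕ} (ρ : Fin L → NNReal)
    (M : Weights d m) (δ : ℝ) (n : ℕ) (γ B : ℝ) (A : Weights d m) : ℝ :=
  B * spectralComplexity ρ M A / (γ * n) * Real.log (width d m) +
    Real.sqrt (Real.log (1 / δ) / n)

/-- The logarithmic factor: the sum of the logarithms of the varying quantities from which
`rate` is built. -/
def logFactor {L : ℕ} {d : Fin (L + 1) → ℕ} {m : Fin L → ℕ} (ρ : Fin L → NNReal)
    (M : Weights d m) (n : ℕ) (γ B : ℝ) (A : Weights d m) : ℝ :=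
  Real.log n + |Real.log γ| + Real.log B + Real.log (spectralComplexity ρ M A)

end SpectralMargin

end

/-! Fix the margin and bounds `a i`, `s i` on the distances to the reference matrices and on the
spectral norms. For finitely many networks in this class, the largest gap between mean and empirical
ramp loss, minus twice the empirical Rademacher complexity, has nonpositive mean by symmetrization.
It moves by at most 3 (unnormalised) when one sample point changes. One use of McDiarmid therefore
bounds the gap by the complexity on the actual sample, so no bound on the data is needed in advance;
this is the source of `9 / (2 * n)`.

The complexity is controlled by metric entropy. The product of a matrix with fixed data is an
ℓ₁-bounded combination of normalised data columns, so Maurey's sampling argument covers it at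
logarithmic cost, with the (2,1) norm as ℓ₁ radius. Covers are composed along the layers: errors are
multiplied by Lipschitz constants and spectral norms, cardinalities multiply. Optimal allocation of
accuracy among the layers gives entropy of order `complexitySum a s ^ 3 / ε ^ 2`, whose exponents
2/3 and 3 become the 2/3 and 3/2 of the spectral complexity. With entropy of this shape every scale
of Dudley's chaining costs the same, and about log₂ n scales suffice.

A finite family is enough because the losses depend continuously on the weights and the class is
separable. A weighted union bound over a grid of margins, distances and norms makes the bound
uniform in all parameters: the `1 / L` shifts are the grid spacing, the logarithms are the prices of
the cells, and the factor 2 from 72 to 144 is the dyadic rounding of the margin.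

For the asymptotic comparison, large spectral norms force the distances `norm21` to be large too.
The shifts then cost at most `(1 + 1 / L) ^ L ≤ 3`, and every logarithm is dominated by `logFactor`.
-/

namespace SpectralMargin

/-! ### McDiarmid's bounded difference inequality. -/

section McDiarmid

variable {Z : Type*} [MeasurableSpace Z] {n : ℕ}

/-- A function of `n` variables that changes by at most `c` when one variable changes. -/
def BoundedDifferences (g : (Fin n → Z) → ℝ) (c : ℝ) : Prop :=
  ∀ S k z, |g (Function.update S k z) - g S| ≤ c

lemma integrable_of_measurable_of_abs_le {Ω : Type*} [MeasurableSpace Ω] {P : Measure Ω}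
    [IsFiniteMeasure P] {g : Ω → ℝ} (hg : Measurable g) {B : ℝ} (hB : ∀ x, |g x| ≤ B) :
    Integrable g P :=
  Integrable.of_bound hg.aestronglyMeasurable B (Eventually.of_forall fun x => hB x)

lemma integral_pi_succ (μ : Measure Z) [IsProbabilityMeasure μ] {F : (Fin (n + 1) → Z) → ℝ}
    (hF : Measurable F) {B : ℝ} (hB : ∀ S, |F S| ≤ B) :
    ∫ S, F S ∂(Measure.pi fun _ : Fin (n + 1) => μ) =
      ∫ S, ∫ z, F (Fin.cons z S) ∂μ ∂(Measure.pi fun _ : Fin n => μ) := by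
  have hmp := (measurePreserving_piFinSuccAbove (fun _ : Fin (n + 1) => μ) 0).symm
  rw [← hmp.integral_comp']
  simp only [MeasurableEquiv.piFinSuccAbove_symm_apply, Fin.insertNthEquiv]
  have hm : Measurable fun p : Z × (Fin n → Z) => F (Fin.cons p.1 p.2) := by
    have h := hF.comp (MeasurableEquiv.piFinSuccAbove (fun _ : Fin (n + 1) => Z) 0).symm.measurable
    simpa [Function.comp_def, Fin.insertNthEquiv] using h
  have := integral_prod_symm (μ := μ) (ν := Measure.pi fun _ : Fin n => μ)
    (fun p : Z × (Fin n → Z) => F (Fin.cons p.1 p.2))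
    (integrable_of_measurable_of_abs_le hm fun p => hB _)
  simpa using this

/-- Hoeffding's lemma, applied on the interval of length `c` that starts at the infimum of `f`.
Oscillation is the form in which bounded differences enter. -/
lemma integral_exp_sub_integral_le (μ : Measure Z) [IsProbabilityMeasure μ] {f : Z → ℝ}
    (hf : Measurable f) {c : ℝ} (hc : ∀ z w, f z - f w ≤ c) (t : ℝ) :
    ∫ z, Real.exp (t * (f z - ∫ w, f w ∂μ)) ∂μ ≤ Real.exp (c ^ 2 * t ^ 2 / 8) := by
  obtain ⟨w⟩ : Nonempty Z := nonempty_of_isProbabilityMeasure μ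
  have hbdd : BddBelow (Set.range f) := ⟨f w - c, by rintro _ ⟨z, rfl⟩; linarith [hc w z]⟩
  have hmem : ∀ z, f z ∈ Set.Icc (⨅ z, f z) ((⨅ z, f z) + c) := fun z =>
    ⟨ciInf_le hbdd z, by
      have : f z - c ≤ ⨅ z, f z := by
        have : Nonempty Z := ⟨w⟩
        exact le_ciInf fun v => by linarith [hc z v]
      linarith⟩
  have h := (ProbabilityTheory.hasSubgaussianMGF_of_mem_Icc (μ := μ) hf.aemeasurable
    (Eventually.of_forall hmem)).mgf_le t
  refine h.trans (le_of_eq ?_)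
  congr 1
  simp only [add_sub_cancel_left, NNReal.coe_pow, NNReal.coe_div, coe_nnnorm, NNReal.coe_ofNat,
    Real.norm_eq_abs, div_pow, sq_abs]
  ring

/-- The moment generating function bound behind McDiarmid's inequality. -/
lemma BoundedDifferences.integral_exp_le (μ : Measure Z) [IsProbabilityMeasure μ] {c : ℝ}
    (t : ℝ) : ∀ {n : ℕ} {g : (Fin n → Z) → ℝ}, BoundedDifferences g c → Measurable g →
      ∀ {B : ℝ}, (∀ S, |g S| ≤ B) →
    ∫ S, Real.exp (t * (g S - ∫ T, g T ∂(Measure.pi fun _ : Fin n => μ)))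
      ∂(Measure.pi fun _ : Fin n => μ) ≤ Real.exp (n * c ^ 2 * t ^ 2 / 8) := by
  intro n
  induction n with
  | zero =>
    intro g _ _ B _
    have : g = fun _ => g default := funext fun S => by rw [Subsingleton.elim S default]
    rw [this]
    simp
  | succ n ih =>
    intro g hd hg B hB
    have hcons : Measurable fun p : Z × (Fin n → Z) => g (Fin.cons p.1 p.2) := by
      have h := hg.comp
        (MeasurableEquiv.piFinSuccAbove (fun _ : Fin (n + 1) => Z) 0).symm.measurable
      simpa [Function.comp_def, Fin.insertNthEquiv] using h
    have hslice : ∀ S, Measurable fun z => g (Fin.cons z S) := fun S =>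
      hcons.comp (measurable_id.prodMk measurable_const)
    have hint : ∀ S, Integrable (fun z => g (Fin.cons z S)) μ := fun S =>
      integrable_of_measurable_of_abs_le (hslice S) fun z => hB _
    -- Integrating out the first variable keeps the mean and the constant `c`. Given the other
    -- variables, the fluctuation around `h` contributes one Hoeffding factor, and the induction
    -- hypothesis handles `h`.
    set h : (Fin n → Z) → ℝ := fun S => ∫ z, g (Fin.cons z S) ∂μ with hh
    have hhm : Measurable h :=
      (hcons.stronglyMeasurable.integral_prod_left' (μ := μ)).measurable
    have hhB : ∀ S, |h S| ≤ B := fun S => by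
      have := norm_integral_le_of_norm_le_const (μ := μ) (f := fun z => g (Fin.cons z S)) (C := B)
        (Eventually.of_forall fun z => hB _)
      simpa using this
    have hhd : BoundedDifferences h c := by
      intro S k z
      have e : h (Function.update S k z) - h S =
          ∫ w, (g (Function.update (Fin.cons w S : Fin (n + 1) → Z) k.succ z) -
            g (Fin.cons w S)) ∂μ := by
        rw [hh, ← integral_sub (hint _) (hint _)]
        simp [Fin.cons_update]
      rw [e]
      have := norm_integral_le_of_norm_le_const (μ := μ) (C := c)
        (f := fun w => g (Function.update (Fin.cons w S : Fin (n + 1) → Z) k.succ z) -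
            g (Fin.cons w S)) (Eventually.of_forall fun w => hd _ _ _)
      simpa using this
    have hmean : ∫ T, g T ∂(Measure.pi fun _ : Fin (n + 1) => μ) =
        ∫ T, h T ∂(Measure.pi fun _ : Fin n => μ) := integral_pi_succ μ hg hB
    set E := ∫ T, h T ∂(Measure.pi fun _ : Fin n => μ) with hE
    rw [hmean]
    have hexpB : ∀ {α : Type _} {f : α → ℝ} (b : ℝ), (∀ x, |f x| ≤ b) → ∀ x,
        |Real.exp (t * (f x - E))| ≤ Real.exp (|t| * (b + |E|)) := by
      intro α f b hb x
      rw [abs_of_pos (Real.exp_pos _)]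
      refine Real.exp_le_exp.2 ((le_abs_self _).trans ?_)
      rw [abs_mul]
      exact mul_le_mul_of_nonneg_left ((abs_sub _ _).trans (by linarith [hb x])) (abs_nonneg t)
    rw [integral_pi_succ μ (F := fun S => Real.exp (t * (g S - E)))
      (by fun_prop) (hexpB B hB)]
    have hinner : ∀ S, ∫ z, Real.exp (t * (g (Fin.cons z S) - E)) ∂μ ≤
        Real.exp (t * (h S - E)) * Real.exp (c ^ 2 * t ^ 2 / 8) := by
      intro S
      have e : ∀ z, Real.exp (t * (g (Fin.cons z S) - E)) =
          Real.exp (t * (h S - E)) * Real.exp (t * (g (Fin.cons z S) - h S)) := fun z => by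
        rw [← Real.exp_add]; ring_nf
      simp_rw [e]
      rw [integral_const_mul]
      refine mul_le_mul_of_nonneg_left ?_ (Real.exp_pos _).le
      refine integral_exp_sub_integral_le μ (hslice S) (fun z w => ?_) t
      have := hd (Fin.cons w S) 0 z
      rw [Fin.update_cons_zero] at this
      exact (le_abs_self _).trans this
    calc _ ≤ ∫ S, Real.exp (t * (h S - E)) * Real.exp (c ^ 2 * t ^ 2 / 8)
          ∂(Measure.pi fun _ : Fin n => μ) := by
          refine integral_mono ?_ ?_ hinner
          · refine integrable_of_measurable_of_abs_le (B := Real.exp (|t| * (B + |E|))) ?_ ?_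
            · have : Measurable fun p : Z × (Fin n → Z) =>
                Real.exp (t * (g (Fin.cons p.1 p.2) - E)) :=
                Real.measurable_exp.comp ((hcons.sub_const E).const_mul t)
              exact (this.stronglyMeasurable.integral_prod_left' (μ := μ)).measurable
            · intro S
              have := norm_integral_le_of_norm_le_const (μ := μ) (C := Real.exp (|t| * (B + |E|)))
                (f := fun z => Real.exp (t * (g (Fin.cons z S) - E)))
                (Eventually.of_forall fun z => hexpB B hB _)
              simpa using this
          · exact (integrable_of_measurable_of_abs_le (by fun_prop) (hexpB B hhB)).mul_const _
      _ = (∫ S, Real.exp (t * (h S - E)) ∂(Measure.pi fun _ : Fin n => μ)) *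
          Real.exp (c ^ 2 * t ^ 2 / 8) := integral_mul_const _ _
      _ ≤ Real.exp (n * c ^ 2 * t ^ 2 / 8) * Real.exp (c ^ 2 * t ^ 2 / 8) :=
          mul_le_mul_of_nonneg_right (ih hhd hhm hhB) (Real.exp_pos _).le
      _ = _ := by rw [← Real.exp_add]; push_cast; ring_nf

/-- **McDiarmid's inequality** for a function whose mean is not positive. -/
lemma BoundedDifferences.measure_gt_le (μ : Measure Z) [IsProbabilityMeasure μ] {c : ℝ}
    (hc : 0 < c) (hn : 0 < n) {g : (Fin n → Z) → ℝ} (hd : BoundedDifferences g c)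
    (hg : Measurable g) {B : ℝ} (hB : ∀ S, |g S| ≤ B)
    (hmean : ∫ S, g S ∂(Measure.pi fun _ : Fin n => μ) ≤ 0) {u : ℝ} (hu : 0 ≤ u) :
    (Measure.pi fun _ : Fin n => μ) {S | u < g S} ≤
      ENNReal.ofReal (Real.exp (-(2 * u ^ 2 / (n * c ^ 2)))) := by
  set P := Measure.pi fun _ : Fin n => μ
  set E := ∫ S, g S ∂P
  have hn' : (0 : ℝ) < n := by exact_mod_cast hn
  -- The minimiser of `n * c ^ 2 * t ^ 2 / 8 - t * u`, the exponent in Chernoff's bound.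
  set t := 4 * u / (n * c ^ 2) with ht
  have ht0 : 0 ≤ t := by positivity
  have hint : Integrable (fun S => Real.exp (t * (g S - E))) P := by
    refine integrable_of_measurable_of_abs_le (B := Real.exp (|t| * (B + |E|))) (by fun_prop) ?_
    intro S
    rw [abs_of_pos (Real.exp_pos _)]
    refine Real.exp_le_exp.2 ((le_abs_self _).trans ?_)
    rw [abs_mul]
    exact mul_le_mul_of_nonneg_left ((abs_sub _ _).trans (by linarith [hB S])) (abs_nonneg t)
  have hmgf := hd.integral_exp_le μ t hg hB
  have hmark := mul_meas_ge_le_integral_of_nonneg (μ := P)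
    (f := fun S => Real.exp (t * (g S - E))) (Eventually.of_forall fun S => (Real.exp_pos _).le)
    hint (Real.exp (t * u))
  -- The sign of the mean enters here: `E ≤ 0` turns `u < g S` into a deviation of at least `u` from
  -- `E`.
  have hsub : {S | u < g S} ⊆ {S | Real.exp (t * u) ≤ Real.exp (t * (g S - E))} := by
    intro S hS
    refine Real.exp_le_exp.2 (mul_le_mul_of_nonneg_left ?_ ht0)
    have : u < g S := hS
    linarith
  have hreal : P.real {S | u < g S} ≤ Real.exp (-(2 * u ^ 2 / (n * c ^ 2))) := by
    have h1 : P.real {S | u < g S} ≤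
        P.real {S | Real.exp (t * u) ≤ Real.exp (t * (g S - E))} := measureReal_mono hsub
    have h2 : Real.exp (t * u) * P.real {S | u < g S} ≤ Real.exp (n * c ^ 2 * t ^ 2 / 8) :=
      ((mul_le_mul_of_nonneg_left h1 (Real.exp_pos _).le).trans hmark).trans hmgf
    have h3 : P.real {S | u < g S} ≤
        Real.exp (n * c ^ 2 * t ^ 2 / 8) / Real.exp (t * u) := by
      rw [le_div_iff₀ (Real.exp_pos _)]; linarith
    rw [← Real.exp_sub] at h3
    refine h3.trans (le_of_eq ?_)
    congr 1
    rw [ht]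
    field_simp
    ring
  rw [← ENNReal.ofReal_toReal (measure_ne_top P {S | u < g S})]
  exact ENNReal.ofReal_le_ofReal hreal

end McDiarmid

/-! ### Symmetrization and uniform deviation for finite classes. -/

section Symmetrization

/-- The sign attached to a Boolean. -/
def boolSign (b : Bool) : ℝ := if b then 1 else -1

lemma boolSign_not (b : Bool) : boolSign (!b) = -boolSign b := by
  cases b <;> simp [boolSign]

lemma abs_boolSign (b : Bool) : |boolSign b| = 1 := by
  cases b <;> simp [boolSign]

/-- The (unnormalised) empirical Rademacher complexity of a family of vectors. -/
noncomputable def signAvg {ι : Type*} {n : ℕ} (v : ι → Fin n → ℝ) : ℝ :=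
  (2 ^ n : ℝ)⁻¹ * ∑ s : Fin n → Bool, ⨆ i, ∑ k, boolSign (s k) * v i k

variable {ι : Type*} [Finite ι] [Nonempty ι] {n : ℕ}

lemma abs_ciSup_sub_ciSup_le {a b : ι → ℝ} {c : ℝ} (h : ∀ i, |a i - b i| ≤ c) :
    |(⨆ i, a i) - ⨆ i, b i| ≤ c := by
  have ha := Set.finite_range a |>.bddAbove
  have hb := Set.finite_range b |>.bddAbove
  rw [abs_sub_le_iff]
  constructor
  · have : ⨆ i, a i ≤ (⨆ i, b i) + c := ciSup_le fun i => by
      linarith [le_ciSup hb i, (abs_le.1 (h i)).2]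
    linarith
  · have : ⨆ i, b i ≤ (⨆ i, a i) + c := ciSup_le fun i => by
      linarith [le_ciSup ha i, (abs_le.1 (h i)).1]
    linarith

lemma abs_ciSup_le {a : ι → ℝ} {c : ℝ} (h : ∀ i, |a i| ≤ c) : |⨆ i, a i| ≤ c := by
  have := abs_ciSup_sub_ciSup_le (a := a) (b := fun _ => 0) (c := c) (by simpa using h)
  simpa using this

lemma sum_signs_const (c : ℝ) : (2 ^ n : ℝ)⁻¹ * ∑ _s : Fin n → Bool, c = c := by
  simp

lemma abs_signAvg_sub_le {v w : ι → Fin n → ℝ} {c : ℝ}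
    (h : ∀ s : Fin n → Bool, ∀ i,
      |∑ k, boolSign (s k) * v i k - ∑ k, boolSign (s k) * w i k| ≤ c) :
    |signAvg v - signAvg w| ≤ c := by
  rw [signAvg, signAvg, ← mul_sub, ← Finset.sum_sub_distrib, abs_mul,
    abs_of_pos (by positivity : (0 : ℝ) < (2 ^ n)⁻¹), ← sum_signs_const (n := n) c]
  refine mul_le_mul_of_nonneg_left ((Finset.abs_sum_le_sum_abs _ _).trans ?_) (by positivity)
  exact Finset.sum_le_sum fun s _ => abs_ciSup_sub_ciSup_le (h s)

lemma abs_sum_le_of_abs_le_one {v : Fin n → ℝ} (h : ∀ k, |v k| ≤ 1) : |∑ k, v k| ≤ n := by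
  refine (Finset.abs_sum_le_sum_abs _ _).trans ((Finset.sum_le_sum fun k _ => h k).trans ?_)
  simp

lemma sum_signs_not (F : (Fin n → Bool) → ℝ) :
    ∑ s : Fin n → Bool, F (fun k => !(s k)) = ∑ s, F s :=
  Fintype.sum_bijective (fun (s : Fin n → Bool) k => !(s k))
    (Function.Involutive.bijective fun s => by simp) _ _ fun _ => rfl

variable {Z : Type*} [MeasurableSpace Z]

lemma integral_comp_of_measurePreserving {α β : Type*} [MeasurableSpace α] [MeasurableSpace β]
    {P : Measure α} {Q : Measure β} {φ : α → β} (hφ : MeasurePreserving φ P Q) {F : β → ℝ}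
    (hF : Measurable F) : ∫ x, F (φ x) ∂P = ∫ y, F y ∂Q := by
  rw [← hφ.map_eq, integral_map hφ.measurable.aemeasurable hF.aestronglyMeasurable]

lemma measurable_signAvg {ι : Type*} [Finite ι] {α : Type*} [MeasurableSpace α] {v : ι → Fin n → α → ℝ}
    (hv : ∀ i k, Measurable (v i k)) : Measurable fun x => signAvg fun i k => v i k x := by
  have : Countable ι := Finite.to_countable
  unfold signAvg
  refine (Finset.measurable_sum _ fun s _ => Measurable.iSup fun i => ?_).const_mul _
  exact Finset.measurable_sum _ fun k _ => (hv i k).const_mul _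

/-- The largest deviation over the class `f` of the sum of the means from the sum over the
sample. -/
noncomputable def maxDeviation (μ : Measure Z) (f : ι → Z → ℝ) (S : Fin n → Z) : ℝ :=
  ⨆ i, (n * ∫ z, f i z ∂μ - ∑ k, f i (S k))

lemma integral_sum_sample (μ : Measure Z) [IsProbabilityMeasure μ] {f : Z → ℝ}
    (hf : Measurable f) (h1 : ∀ z, |f z| ≤ 1) :
    ∫ S, ∑ k, f (S k) ∂(Measure.pi fun _ : Fin n => μ) = n * ∫ z, f z ∂μ := by
  rw [integral_finsetSum]
  · have : ∀ k : Fin n, ∫ S, f (S k) ∂(Measure.pi fun _ : Fin n => μ) = ∫ z, f z ∂μ := fun k =>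
      integral_comp_of_measurePreserving (measurePreserving_eval (fun _ : Fin n => μ) k) hf
    simp [this]
  · exact fun k _ => integrable_of_measurable_of_abs_le (hf.comp (measurable_pi_apply k))
      fun S => h1 _

lemma measurable_maxDeviation {ι : Type*} [Finite ι] (μ : Measure Z) {f : ι → Z → ℝ} (hf : ∀ i, Measurable (f i)) :
    Measurable fun S : Fin n → Z => maxDeviation μ f S := by
  have : Countable ι := Finite.to_countable
  exact Measurable.iSup fun i => measurable_const.sub
    (Finset.measurable_sum _ fun k _ => (hf i).comp (measurable_pi_apply k))

lemma abs_maxDeviation_le (μ : Measure Z) [IsProbabilityMeasure μ] {f : ι → Z → ℝ}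
    (h1 : ∀ i z, |f i z| ≤ 1) (S : Fin n → Z) : |maxDeviation μ f S| ≤ n + n :=
  abs_ciSup_le fun i => by
    have hmean : ‖∫ z, f i z ∂μ‖ ≤ 1 * μ.real Set.univ :=
      norm_integral_le_of_norm_le_const (Eventually.of_forall fun z => h1 i z)
    simp only [probReal_univ, mul_one, Real.norm_eq_abs] at hmean
    refine (abs_sub _ _).trans (add_le_add ?_ (abs_sum_le_of_abs_le_one fun k => h1 i _))
    rw [abs_mul, abs_of_nonneg (Nat.cast_nonneg n)]
    exact mul_le_of_le_one_right (Nat.cast_nonneg n) hmean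

lemma abs_signAvg_le {v : ι → Fin n → ℝ} (h : ∀ i k, |v i k| ≤ 1) : |signAvg v| ≤ n := by
  have := abs_signAvg_sub_le (v := v) (w := fun _ _ => 0) (c := n) fun s i => by
    simp only [mul_zero, Finset.sum_const_zero, sub_zero]
    refine abs_sum_le_of_abs_le_one fun k => ?_
    rw [abs_mul, abs_boolSign, one_mul]
    exact h i k
  simpa [signAvg] using this

/-- The symmetrization inequality. -/
lemma integral_maxDeviation_le (μ : Measure Z) [IsProbabilityMeasure μ] {f : ι → Z → ℝ}
    (hf : ∀ i, Measurable (f i)) (h1 : ∀ i z, |f i z| ≤ 1) :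
    ∫ S, maxDeviation μ f S ∂(Measure.pi fun _ : Fin n => μ) ≤
      2 * ∫ S, signAvg (fun i k => f i (S k)) ∂(Measure.pi fun _ : Fin n => μ) := by
  have : Countable ι := Finite.to_countable
  set P := Measure.pi fun _ : Fin n => μ with hP
  set PP := Measure.pi fun _ : Fin n => μ.prod μ with hPP
  have hbd : ∀ a : ι → ℝ, BddAbove (Set.range a) := fun a => (Set.finite_range a).bddAbove
  -- the ghost sample
  let G : (Fin n → Z) → (Fin n → Z) → ℝ := fun S T => ⨆ i, ∑ k, (f i (T k) - f i (S k))
  have h2 : ∀ i z w, |f i z - f i w| ≤ 2 := fun i z w =>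
    (abs_sub _ _).trans (by linarith [h1 i z, h1 i w])
  have hGm : Measurable fun p : (Fin n → Z) × (Fin n → Z) => G p.1 p.2 :=
    Measurable.iSup fun i => Finset.measurable_sum _ fun k _ =>
      ((hf i).comp ((measurable_pi_apply k).comp measurable_snd)).sub
        ((hf i).comp ((measurable_pi_apply k).comp measurable_fst))
  have hGb : ∀ S T, |G S T| ≤ n * 2 := fun S T => abs_ciSup_le fun i =>
    (Finset.abs_sum_le_sum_abs _ _).trans
      ((Finset.sum_le_sum fun k _ => h2 i (T k) (S k)).trans (by simp))
  have hDm : Measurable fun S : Fin n → Z => maxDeviation μ f S := measurable_maxDeviation μ hf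
  have hDb : ∀ S : Fin n → Z, |maxDeviation μ f S| ≤ n + n := abs_maxDeviation_le μ h1
  have hGslice : ∀ S, Integrable (fun T => G S T) P := fun S =>
    integrable_of_measurable_of_abs_le (hGm.comp (measurable_const.prodMk measurable_id))
      fun T => hGb S T
  -- The true means are expectations over the ghost sample, and a supremum of expectations is at
  -- most the expectation of the supremum.
  have hstep : ∀ S, maxDeviation μ f S ≤ ∫ T, G S T ∂P := by
    intro S
    refine ciSup_le fun i => ?_
    have hsum : Integrable (fun T : Fin n → Z => ∑ k, f i (T k)) P :=
      integrable_of_measurable_of_abs_le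
        (Finset.measurable_sum _ fun k _ => (hf i).comp (measurable_pi_apply k))
        fun T => abs_sum_le_of_abs_le_one fun k => h1 i _
    have e : n * ∫ z, f i z ∂μ - ∑ k, f i (S k) =
        ∫ T, ∑ k, (f i (T k) - f i (S k)) ∂P := by
      simp_rw [Finset.sum_sub_distrib]
      rw [integral_sub hsum (integrable_const _), integral_sum_sample μ (hf i) (h1 i)]
      simp
    rw [e]
    refine integral_mono ?_ (hGslice S) fun T => le_ciSup (hbd fun i =>
      ∑ k, (f i (T k) - f i (S k))) i
    simp_rw [Finset.sum_sub_distrib]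
    exact hsum.sub (integrable_const _)
  have hGint : Integrable (fun p : (Fin n → Z) × (Fin n → Z) => G p.1 p.2) (P.prod P) :=
    integrable_of_measurable_of_abs_le hGm fun p => hGb _ _
  -- the signed version on the space of pairs
  let Q : (Fin n → Bool) → (Fin n → Z × Z) → ℝ := fun s w =>
    ⨆ i, ∑ k, boolSign (s k) * (f i (w k).2 - f i (w k).1)
  have hfst : ∀ i k, Measurable fun w : Fin n → Z × Z => f i (w k).1 := fun i k =>
    (hf i).comp (measurable_fst.comp (measurable_pi_apply k))
  have hsnd : ∀ i k, Measurable fun w : Fin n → Z × Z => f i (w k).2 := fun i k =>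
    (hf i).comp (measurable_snd.comp (measurable_pi_apply k))
  have hQm : ∀ s, Measurable (Q s) := fun s => Measurable.iSup fun i =>
    Finset.measurable_sum _ fun k _ => ((hsnd i k).sub (hfst i k)).const_mul _
  have hQb : ∀ s w, |Q s w| ≤ n * 2 := fun s w => abs_ciSup_le fun i => by
    refine (Finset.abs_sum_le_sum_abs _ _).trans
      ((Finset.sum_le_sum (g := fun _ => 2) fun k _ => ?_).trans (by simp))
    rw [abs_mul, abs_boolSign, one_mul]
    exact h2 i _ _
  have hQint : ∀ s, Integrable (Q s) PP := fun s =>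
    integrable_of_measurable_of_abs_le (hQm s) (hQb s)
  -- Exchanging the two members of the `k`-th pair wherever the sign is -1 preserves the product
  -- measure, so the signed supremum has the same mean for every sign pattern.
  have hQ : ∀ s, ∫ w, Q s w ∂PP = ∫ p, G p.1 p.2 ∂(P.prod P) := by
    intro s
    have hswap : MeasurePreserving (fun (w : Fin n → Z × Z) k =>
        (if s k then id else Prod.swap) (w k)) PP PP := by
      refine measurePreserving_pi _ _ fun k => ?_
      by_cases hk : s k
      · simpa [hk] using MeasurePreserving.id (μ.prod μ)
      · simpa [hk] using Measure.measurePreserving_swap (μ := μ) (ν := μ)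
    rw [← integral_comp_of_measurePreserving
      (measurePreserving_arrowProdEquivProdArrow Z Z (Fin n) (fun _ => μ) (fun _ => μ)) hGm,
      ← integral_comp_of_measurePreserving hswap (hQm s)]
    refine integral_congr_ae (Eventually.of_forall fun w => ?_)
    change (⨆ i, _) = ⨆ i, _
    congr 1 with i
    refine Finset.sum_congr rfl fun k _ => ?_
    by_cases hk : s k <;>
      simp [hk, boolSign, MeasurableEquiv.arrowProdEquivProdArrow, Equiv.arrowProdEquivProdArrow]
  have hA : ∀ φ : Z × Z → Z, MeasurePreserving φ (μ.prod μ) μ →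
      Integrable (fun w : Fin n → Z × Z => signAvg fun i k => f i (φ (w k))) PP ∧
      ∫ w, signAvg (fun i k => f i (φ (w k))) ∂PP = ∫ S, signAvg (fun i k => f i (S k)) ∂P := by
    intro φ hφ
    have hm : Measurable fun S : Fin n → Z => signAvg fun i k => f i (S k) :=
      measurable_signAvg fun i k => (hf i).comp (measurable_pi_apply k)
    have hmp : MeasurePreserving (fun (w : Fin n → Z × Z) k => φ (w k)) PP P :=
      measurePreserving_pi _ _ fun _ => hφ
    refine ⟨integrable_of_measurable_of_abs_le (hm.comp hmp.measurable) (B := n) fun w =>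
      abs_signAvg_le fun i k => h1 i _, integral_comp_of_measurePreserving hmp hm⟩
  -- The minus sign before the first sample is absorbed by flipping all signs, which permutes the
  -- sign patterns. Both halves are then Rademacher averages, whence the factor 2.
  have hpt : ∀ w, (2 ^ n : ℝ)⁻¹ * ∑ s, Q s w ≤
      signAvg (fun i k => f i (w k).2) + signAvg (fun i k => f i (w k).1) := by
    intro w
    have e : signAvg (fun i k => f i (w k).1) =
        (2 ^ n : ℝ)⁻¹ * ∑ s : Fin n → Bool, ⨆ i, ∑ k, boolSign (!(s k)) * f i (w k).1 := by
      rw [signAvg, ← sum_signs_not fun s => ⨆ i, ∑ k, boolSign (s k) * f i (w k).1]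
    rw [e, signAvg, ← mul_add, ← Finset.sum_add_distrib]
    refine mul_le_mul_of_nonneg_left (Finset.sum_le_sum fun s _ => ciSup_le fun i => ?_)
      (by positivity)
    refine le_trans (le_of_eq ?_) (add_le_add
      (le_ciSup (hbd fun i => ∑ k, boolSign (s k) * f i (w k).2) i)
      (le_ciSup (hbd fun i => ∑ k, boolSign (!(s k)) * f i (w k).1) i))
    rw [← Finset.sum_add_distrib]
    refine Finset.sum_congr rfl fun k _ => ?_
    rw [boolSign_not]; ring
  obtain ⟨hi1, he1⟩ := hA Prod.fst measurePreserving_fst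
  obtain ⟨hi2, he2⟩ := hA Prod.snd measurePreserving_snd
  calc ∫ S, maxDeviation μ f S ∂P ≤ ∫ S, ∫ T, G S T ∂P ∂P :=
        integral_mono (integrable_of_measurable_of_abs_le hDm hDb) hGint.integral_prod_left hstep
    _ = ∫ p, G p.1 p.2 ∂(P.prod P) := (integral_prod _ hGint).symm
    _ = (2 ^ n : ℝ)⁻¹ * ∑ s, ∫ w, Q s w ∂PP := by
        simp_rw [hQ]; rw [sum_signs_const]
    _ = ∫ w, (2 ^ n : ℝ)⁻¹ * ∑ s, Q s w ∂PP := by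
        rw [integral_const_mul, integral_finsetSum _ fun s _ => hQint s]
    _ ≤ ∫ w, (signAvg (fun i k => f i (w k).2) + signAvg (fun i k => f i (w k).1)) ∂PP :=
        integral_mono ((integrable_finsetSum _ fun s _ => hQint s).const_mul _)
          (hi2.add hi1) hpt
    _ = _ := by rw [integral_add hi2 hi1, he1, he2]; ring

/-- A uniform deviation bound for a finite class in terms of its empirical Rademacher
complexity. -/
lemma measure_exists_deviation_le (μ : Measure Z) [IsProbabilityMeasure μ] {f : ι → Z → ℝ}
    (hf : ∀ i, Measurable (f i)) (h0 : ∀ i z, 0 ≤ f i z) (h1 : ∀ i z, f i z ≤ 1)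
    (hn : 0 < n) {t : ℝ} (ht : 0 ≤ t) :
    (Measure.pi fun _ : Fin n => μ) {S | ∃ i, (n : ℝ)⁻¹ * ∑ k, f i (S k) +
        2 / n * signAvg (fun i k => f i (S k)) + t < ∫ z, f i z ∂μ} ≤
      ENNReal.ofReal (Real.exp (-(2 * n * t ^ 2 / 9))) := by
  have : Countable ι := Finite.to_countable
  have hn' : (0 : ℝ) < n := by exact_mod_cast hn
  have habs : ∀ i z, |f i z| ≤ 1 := fun i z => abs_le.2 ⟨by linarith [h0 i z], h1 i z⟩
  have hdiff1 : ∀ i z w, |f i z - f i w| ≤ 1 := fun i z w => by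
    rw [abs_le]; constructor <;> linarith [h0 i z, h0 i w, h1 i z, h1 i w]
  set P := Measure.pi fun _ : Fin n => μ
  let g : (Fin n → Z) → ℝ := fun S => maxDeviation μ f S - 2 * signAvg (fun i k => f i (S k))
  have hDm : Measurable fun S : Fin n → Z => maxDeviation μ f S := measurable_maxDeviation μ hf
  have hDb : ∀ S : Fin n → Z, |maxDeviation μ f S| ≤ n + n := abs_maxDeviation_le μ habs
  have hSm : Measurable fun S : Fin n → Z => signAvg fun i k => f i (S k) :=
    measurable_signAvg fun i k => (hf i).comp (measurable_pi_apply k)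
  have hSb : ∀ S : Fin n → Z, |signAvg fun i k => f i (S k)| ≤ n := fun S =>
    abs_signAvg_le fun i k => habs i _
  have hgm : Measurable g := hDm.sub (hSm.const_mul 2)
  have hgb : ∀ S, |g S| ≤ (n + n) + 2 * n := fun S => by
    refine (abs_sub _ _).trans (add_le_add (hDb S) ?_)
    rw [abs_mul, abs_two]
    linarith [hSb S]
  have hupd : ∀ (a : Fin n → ℝ) i (S : Fin n → Z) j z, |a j| ≤ 1 →
      |∑ k, a k * f i (Function.update S j z k) - ∑ k, a k * f i (S k)| ≤ 1 := by
    intro a i S j z ha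
    rw [← Finset.sum_sub_distrib, Finset.sum_eq_single j]
    · rw [Function.update_self, ← mul_sub, abs_mul]
      exact mul_le_one₀ ha (abs_nonneg _) (hdiff1 i _ _)
    · intro k _ hk
      rw [Function.update_of_ne hk, sub_self]
    · simp
  -- 3 = 1 + 2 · 1: changing one sample point moves `maxDeviation` by at most 1 and `signAvg` by at
  -- most 1, since the losses lie in [0, 1].
  have hgd : BoundedDifferences g 3 := by
    intro S j z
    have hA : |maxDeviation μ f (Function.update S j z) - maxDeviation μ f S| ≤ 1 := by
      refine abs_ciSup_sub_ciSup_le fun i => ?_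
      have := hupd (fun _ => 1) i S j z (by simp)
      simp only [one_mul] at this
      rw [sub_sub_sub_cancel_left, abs_sub_comm]
      exact this
    have hB : |signAvg (fun i k => f i (Function.update S j z k)) -
        signAvg (fun i k => f i (S k))| ≤ 1 :=
      abs_signAvg_sub_le fun s i => hupd (fun k => boolSign (s k)) i S j z (abs_boolSign _).le
    rw [abs_le] at *
    constructor <;> simp only [g] <;> linarith
  have hmean : ∫ S, g S ∂P ≤ 0 := by
    have := integral_maxDeviation_le (n := n) μ hf habs
    simp only [g]
    rw [integral_sub (integrable_of_measurable_of_abs_le hDm hDb)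
      ((integrable_of_measurable_of_abs_le hSm hSb).const_mul 2), integral_const_mul]
    linarith
  have := hgd.measure_gt_le μ (by norm_num) hn hgm hgb hmean (u := n * t) (by positivity)
  refine (measure_mono ?_).trans (this.trans (le_of_eq ?_))
  · rintro S ⟨i, hi⟩
    have h2 : n * ∫ z, f i z ∂μ - ∑ k, f i (S k) ≤ maxDeviation μ f S :=
      le_ciSup (f := fun i => n * ∫ z, f i z ∂μ - ∑ k, f i (S k))
        (Set.finite_range _).bddAbove i
    have h3 := mul_lt_mul_of_pos_left hi hn'
    have e : (n : ℝ) * ((n : ℝ)⁻¹ * ∑ k, f i (S k) + 2 / n * signAvg (fun i k => f i (S k)) + t) =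
        ∑ k, f i (S k) + 2 * signAvg (fun i k => f i (S k)) + n * t := by
      field_simp
    rw [e] at h3
    change n * t < maxDeviation μ f S - 2 * signAvg (fun i k => f i (S k))
    linarith
  · congr 2
    field_simp
    norm_num

end Symmetrization

/-! ### Maurey's empirical method and covers of absolutely convex hulls. -/

section Maurey

variable {E : Type*} [NormedAddCommGroup E] [InnerProductSpace ℝ E]

/-- If `i` is drawn with probabilities `p`, the added vector is centred, so the expected square is
`‖S‖ ^ 2` plus a variance of at most `b ^ 2`. Some `i` does no worse than the average. -/
lemma exists_norm_add_sub_sq_le {κ : Type*} [Fintype κ] {V : κ → E} {p : κ → ℝ}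
    (hp : ∀ i, 0 ≤ p i) (hsum : ∑ i, p i = 1) {b : ℝ} (hV : ∀ i, ‖V i‖ ≤ b) (S : E) :
    ∃ i, ‖S + (V i - ∑ i, p i • V i)‖ ^ 2 ≤ ‖S‖ ^ 2 + b ^ 2 := by
  set f := ∑ i, p i • V i with hf
  by_contra! hcon
  have hb : ∀ i, ‖V i‖ ^ 2 ≤ b ^ 2 := fun i => pow_le_pow_left₀ (norm_nonneg _) (hV i) 2
  have h1 : ∑ i, p i * ‖S + (V i - f)‖ ^ 2 ≤ ‖S‖ ^ 2 + b ^ 2 := by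
    have e : ∀ i, p i * ‖S + (V i - f)‖ ^ 2 =
        p i * ‖S - f‖ ^ 2 + 2 * inner ℝ (S - f) (p i • V i) + p i * ‖V i‖ ^ 2 := fun i => by
      rw [show S + (V i - f) = (S - f) + V i by abel, norm_add_sq_real, inner_smul_right]
      ring
    simp_rw [e, Finset.sum_add_distrib, ← Finset.mul_sum, ← Finset.sum_mul, hsum, ← inner_sum]
    rw [← hf]
    have h2 : ∑ i, p i * ‖V i‖ ^ 2 ≤ b ^ 2 := by
      calc _ ≤ ∑ i, p i * b ^ 2 :=
            Finset.sum_le_sum fun i _ => mul_le_mul_of_nonneg_left (hb i) (hp i)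
        _ = b ^ 2 := by rw [← Finset.sum_mul, hsum, one_mul]
    have h3 : ‖S‖ ^ 2 = ‖S - f‖ ^ 2 + 2 * inner ℝ (S - f) f + ‖f‖ ^ 2 := by
      rw [← norm_add_sq_real, sub_add_cancel]
    nlinarith [sq_nonneg ‖f‖]
  obtain ⟨i, -, hi⟩ : ∃ i ∈ Finset.univ, 0 < p i := by
    by_contra! h
    have : ∑ i, p i ≤ 0 := Finset.sum_nonpos h
    linarith
  have h2 : ∑ j, p j * (‖S‖ ^ 2 + b ^ 2) < ∑ j, p j * ‖S + (V j - f)‖ ^ 2 :=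
    Finset.sum_lt_sum (fun j _ => mul_le_mul_of_nonneg_left (hcon j).le (hp j))
      ⟨i, Finset.mem_univ i, mul_lt_mul_of_pos_left (hcon i) hi⟩
  rw [← Finset.sum_mul, hsum, one_mul] at h2
  linarith

/-- **Maurey's lemma**: a convex combination of vectors of norm at most `b` is approximated by
an average of `k` of them. -/
lemma exists_sum_approx {κ : Type*} [Fintype κ] {V : κ → E} {p : κ → ℝ}
    (hp : ∀ i, 0 ≤ p i) (hsum : ∑ i, p i = 1) {b : ℝ} (hV : ∀ i, ‖V i‖ ≤ b) (k : ℕ) :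
    ∃ s : Fin k → κ, ‖∑ j, V (s j) - (k : ℝ) • ∑ i, p i • V i‖ ^ 2 ≤ k * b ^ 2 := by
  induction k with
  | zero => exact ⟨Fin.elim0, by simp⟩
  | succ k ih =>
    obtain ⟨s, hs⟩ := ih
    obtain ⟨i, hi⟩ := exists_norm_add_sub_sq_le hp hsum hV
      (∑ j, V (s j) - (k : ℝ) • ∑ i, p i • V i)
    refine ⟨Fin.snoc s i, ?_⟩
    rw [Fin.sum_univ_castSucc]
    simp only [Fin.snoc_castSucc, Fin.snoc_last]
    have e : ∑ j, V (s j) + V i - ((k + 1 : ℕ) : ℝ) • ∑ i, p i • V i =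
        ∑ j, V (s j) - (k : ℝ) • ∑ i, p i • V i + (V i - ∑ i, p i • V i) := by
      push_cast
      rw [add_smul, one_smul]
      abel
    rw [e]
    push_cast
    linarith

lemma norm_sum_smul_le {κ : Type*} [Fintype κ] {e : κ → E} (he : ∀ i, ‖e i‖ ≤ 1) (w : κ → ℝ) :
    ‖∑ i, w i • e i‖ ≤ ∑ i, |w i| := by
  refine (norm_sum_le _ _).trans (Finset.sum_le_sum fun i _ => ?_)
  rw [norm_smul, Real.norm_eq_abs]
  exact mul_le_of_le_one_right (abs_nonneg _) (he i)

/-- A combination of ℓ₁ weight at most `g` is a convex combination of the vectors `± g • e i`, to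
which Maurey's lemma applies. -/
lemma exists_signed_average_approx {κ : Type*} [Fintype κ] [Nonempty κ] {e : κ → E}
    (he : ∀ i, ‖e i‖ ≤ 1) {g : ℝ} (hg : 0 < g) {k : ℕ} (hk : 0 < k) {w : κ → ℝ}
    (hw : ∑ i, |w i| ≤ g) :
    ∃ s : Fin k → κ × Bool,
      ‖∑ i, w i • e i - (k : ℝ)⁻¹ • ∑ j, (g * boolSign (s j).2) • e (s j).1‖ ≤
        g / Real.sqrt k := by
  have hN : (0 : ℝ) < Fintype.card κ := by exact_mod_cast Fintype.card_pos
  have hk' : (0 : ℝ) < k := by exact_mod_cast hk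
  -- The unused probability mass, spread evenly over all signed atoms. Opposite signs cancel, so the
  -- total becomes 1 while the combination is unchanged.
  set r := (1 - (∑ i, |w i|) / g) / (2 * Fintype.card κ) with hr
  have hr0 : 0 ≤ r := by
    have : (∑ i, |w i|) / g ≤ 1 := (div_le_one hg).2 hw
    exact div_nonneg (by linarith) (by positivity)
  let V : κ × Bool → E := fun q => (g * boolSign q.2) • e q.1
  let p : κ × Bool → ℝ := fun q => (|w q.1| + boolSign q.2 * w q.1) / (2 * g) + r
  have hV : ∀ q, ‖V q‖ ≤ g := fun q => by
    rw [norm_smul, Real.norm_eq_abs, abs_mul, abs_boolSign, mul_one, abs_of_pos hg]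
    exact mul_le_of_le_one_right hg.le (he _)
  have hp : ∀ q, 0 ≤ p q := fun q => by
    refine add_nonneg (div_nonneg ?_ (by positivity)) hr0
    have h := neg_abs_le (boolSign q.2 * w q.1)
    rw [abs_mul, abs_boolSign, one_mul] at h
    linarith
  have hsum : ∑ q, p q = 1 := by
    rw [Fintype.sum_prod_type]
    have : ∀ i, ∑ b : Bool, p (i, b) = |w i| / g + 2 * r := fun i => by
      simp only [p, Fintype.sum_bool, boolSign]
      norm_num
      field_simp
      ring
    simp_rw [this, Finset.sum_add_distrib, ← Finset.sum_div]
    simp only [Finset.sum_const, Finset.card_univ, nsmul_eq_mul, hr]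
    field_simp
    ring
  have hcomb : ∑ q, p q • V q = ∑ i, w i • e i := by
    rw [Fintype.sum_prod_type]
    refine Finset.sum_congr rfl fun i _ => ?_
    simp only [p, V, Fintype.sum_bool, boolSign, smul_smul, ← add_smul]
    congr 1
    norm_num
    field_simp
    ring
  obtain ⟨s, hs⟩ := exists_sum_approx hp hsum hV k
  refine ⟨s, ?_⟩
  rw [hcomb] at hs
  have e1 : ∑ i, w i • e i - (k : ℝ)⁻¹ • ∑ j, (g * boolSign (s j).2) • e (s j).1 =
      -((k : ℝ)⁻¹ • (∑ j, V (s j) - (k : ℝ) • ∑ i, w i • e i)) := by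
    rw [smul_sub, smul_smul, inv_mul_cancel₀ hk'.ne', one_smul, neg_sub]
  rw [e1, norm_neg, norm_smul, norm_inv, Real.norm_of_nonneg hk'.le]
  have h2 : ‖∑ j, V (s j) - (k : ℝ) • ∑ i, w i • e i‖ ≤ Real.sqrt k * g := by
    rw [← Real.sqrt_sq hg.le, ← Real.sqrt_mul hk'.le]
    exact Real.le_sqrt_of_sq_le hs
  calc _ ≤ (k : ℝ)⁻¹ * (Real.sqrt k * g) := mul_le_mul_of_nonneg_left h2 (by positivity)
    _ = g / Real.sqrt k := by
      have : (k : ℝ) = Real.sqrt k * Real.sqrt k := (Real.mul_self_sqrt hk'.le).symm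
      have hs0 : 0 < Real.sqrt k := Real.sqrt_pos.2 hk'
      rw [eq_div_iff hs0.ne']
      nth_rewrite 1 [this]
      field_simp

/-- A small cover of the absolutely convex hull of finitely many vectors. -/
lemma exists_cover_absConvex {κ : Type*} [Fintype κ] {e : κ → E} (he : ∀ i, ‖e i‖ ≤ 1)
    {g x N : ℝ} (hg : 0 ≤ g) (hx : 0 < x) (hN : 1 ≤ N) (hκ : 2 * (Fintype.card κ : ℝ) ≤ N) :
    ∃ C : Finset E, Real.log C.card ≤ 2 * x * Real.log N ∧
      ∀ w : κ → ℝ, ∑ i, |w i| ≤ g → ∃ c ∈ C, ‖∑ i, w i • e i - c‖ ≤ g / Real.sqrt x := by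
  classical
  have hlog : 0 ≤ Real.log N := Real.log_nonneg hN
  have hsx : 0 < Real.sqrt x := Real.sqrt_pos.2 hx
  -- For `x < 1` the origin alone is accurate enough. Excluding this case gives `⌈x⌉₊ ≤ 2 * x`, the
  -- source of the factor 2 in the entropy.
  by_cases htriv : x < 1 ∨ IsEmpty κ ∨ g = 0
  · refine ⟨{0}, by simpa using by positivity, fun w hw => ⟨0, by simp, ?_⟩⟩
    rw [sub_zero]
    have hle := (norm_sum_smul_le he w).trans hw
    rcases htriv with h | h | h
    · refine hle.trans ?_
      rw [le_div_iff₀ hsx]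
      refine mul_le_of_le_one_right hg ?_
      rw [Real.sqrt_le_left zero_le_one]
      linarith
    · simp only [Finset.univ_eq_empty, Finset.sum_empty, norm_zero]
      positivity
    · rw [h] at hle ⊢
      simpa using hle
  · push Not at htriv
    obtain ⟨hx1, hne, hg0⟩ := htriv
    have hgpos : 0 < g := lt_of_le_of_ne hg (Ne.symm hg0)
    set k := ⌈x⌉₊ with hk
    have hkx : x ≤ k := Nat.le_ceil x
    have hk0 : 0 < k := Nat.ceil_pos.2 hx
    have hk2 : (k : ℝ) ≤ 2 * x := by
      have := Nat.ceil_lt_add_one hx.le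
      linarith
    refine ⟨Finset.univ.image fun s : Fin k → κ × Bool =>
      (k : ℝ)⁻¹ • ∑ j, (g * boolSign (s j).2) • e (s j).1, ?_, fun w hw => ?_⟩
    · have hne' : (Finset.univ.image fun s : Fin k → κ × Bool =>
          (k : ℝ)⁻¹ • ∑ j, (g * boolSign (s j).2) • e (s j).1).Nonempty :=
        Finset.univ_nonempty.image _
      have hcard : ((Finset.univ.image fun s : Fin k → κ × Bool =>
          (k : ℝ)⁻¹ • ∑ j, (g * boolSign (s j).2) • e (s j).1).card : ℝ) ≤ N ^ k := by
        have h1 : (Finset.univ.image fun s : Fin k → κ × Bool =>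
          (k : ℝ)⁻¹ • ∑ j, (g * boolSign (s j).2) • e (s j).1).card ≤ (Fintype.card κ * 2) ^ k := by
          refine Finset.card_image_le.trans (le_of_eq ?_)
          simp
        calc _ ≤ (((Fintype.card κ * 2) ^ k : ℕ) : ℝ) := by exact_mod_cast h1
          _ = (2 * (Fintype.card κ : ℝ)) ^ k := by push_cast; ring
          _ ≤ N ^ k := pow_le_pow_left₀ (by positivity) hκ k
      calc _ ≤ Real.log (N ^ k) := Real.log_le_log (by exact_mod_cast hne'.card_pos) hcard
        _ = k * Real.log N := Real.log_pow _ _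
        _ ≤ _ := mul_le_mul_of_nonneg_right hk2 hlog
    · obtain ⟨s, hs⟩ := exists_signed_average_approx he hgpos hk0 hw
      refine ⟨_, Finset.mem_image_of_mem _ (Finset.mem_univ s), hs.trans ?_⟩
      exact div_le_div_of_nonneg_left hg hsx (Real.sqrt_le_sqrt hkx)

/-- Metric projection to a complete convex set does not increase distances to its points. -/
lemma exists_projection {K : Set E} (hne : K.Nonempty) (hcomplete : IsComplete K)
    (hconv : Convex ℝ K) (c : E) : ∃ v ∈ K, ∀ y ∈ K, ‖y - v‖ ≤ ‖y - c‖ := by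
  obtain ⟨v, hv, hmin⟩ := exists_norm_eq_iInf_of_complete_convex hne hcomplete hconv c
  refine ⟨v, hv, fun y hy => ?_⟩
  -- The angle at the projection is obtuse, so the cross term in the expansion of `‖y - c‖ ^ 2` only
  -- helps.
  have h := (norm_eq_iInf_iff_real_inner_le_zero hconv hv).1 hmin y hy
  have e : ‖y - c‖ ^ 2 = ‖y - v‖ ^ 2 - 2 * inner ℝ (c - v) (y - v) + ‖c - v‖ ^ 2 := by
    rw [show y - c = (y - v) - (c - v) by abel, norm_sub_sq_real, real_inner_comm]
  refine le_of_sq_le_sq ?_ (norm_nonneg _)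
  nlinarith [sq_nonneg ‖c - v‖]

end Maurey

/-! ### Covers of a single linear layer. -/

section LayerCover

/-- `n` data points in `ℝ^q`, with the entrywise `ℓ₂` norm. -/
abbrev DataSpace (n q : ℕ) : Type := PiLp 2 fun _ : Fin n => EuclideanSpace ℝ (Fin q)

/-- Application of a matrix to each data point. -/
noncomputable def mulData {n p q : ℕ} (A : Matrix (Fin p) (Fin q) ℝ) (Z : DataSpace n q) :
    DataSpace n p :=
  WithLp.toLp 2 fun i => WithLp.toLp 2 (A.mulVec (Z i))

lemma mulData_apply {n p q : ℕ} (A : Matrix (Fin p) (Fin q) ℝ) (Z : DataSpace n q) (i : Fin n)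
    (r : Fin p) : mulData A Z i r = ∑ c, A r c * Z i c := rfl

lemma mulData_sub_matrix {n p q : ℕ} (A B : Matrix (Fin p) (Fin q) ℝ) (Z : DataSpace n q) :
    mulData (A - B) Z = mulData A Z - mulData B Z := by
  ext i r
  simp [mulData_apply, sub_mul, Finset.sum_sub_distrib]

lemma mulData_sub {n p q : ℕ} (A : Matrix (Fin p) (Fin q) ℝ) (Y Z : DataSpace n q) :
    mulData A (Y - Z) = mulData A Y - mulData A Z := by
  ext i r
  simp [mulData_apply, mul_sub, Finset.sum_sub_distrib]

lemma dataSpace_norm_sq {n q : ℕ} (Z : DataSpace n q) : ‖Z‖ ^ 2 = ∑ i, ‖Z i‖ ^ 2 := by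
  rw [PiLp.norm_sq_eq_of_L2]

lemma dataSpace_norm_sq_entries {n q : ℕ} (Z : DataSpace n q) :
    ‖Z‖ ^ 2 = ∑ c, ∑ i, Z i c ^ 2 := by
  rw [dataSpace_norm_sq, Finset.sum_comm]
  refine Finset.sum_congr rfl fun i _ => ?_
  rw [EuclideanSpace.norm_sq_eq]
  simp

lemma norm_mulVec_le {p q : ℕ} (A : Matrix (Fin p) (Fin q) ℝ) (z : EuclideanSpace ℝ (Fin q)) :
    ‖(WithLp.toLp 2 (A.mulVec z) : EuclideanSpace ℝ (Fin p))‖ ≤ spectralNorm A * ‖z‖ :=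
  Matrix.l2_opNorm_mulVec A z

lemma spectralNorm_nonneg {p q : ℕ} (A : Matrix (Fin p) (Fin q) ℝ) : 0 ≤ spectralNorm A := by
  open scoped Matrix.Norms.L2Operator in
  exact norm_nonneg A

lemma norm_dataSpace_le_of_forall {n p q : ℕ} {Y : DataSpace n p} {Z : DataSpace n q} {s : ℝ}
    (hs : 0 ≤ s) (h : ∀ i, ‖Y i‖ ≤ s * ‖Z i‖) : ‖Y‖ ≤ s * ‖Z‖ := by
  refine le_of_sq_le_sq ?_ (by positivity)
  rw [mul_pow, dataSpace_norm_sq, dataSpace_norm_sq, Finset.mul_sum]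
  refine Finset.sum_le_sum fun i _ => ?_
  rw [← mul_pow]
  exact pow_le_pow_left₀ (norm_nonneg _) (h i) 2

lemma norm_mulData_le {n p q : ℕ} (A : Matrix (Fin p) (Fin q) ℝ) (Z : DataSpace n q) :
    ‖mulData A Z‖ ≤ spectralNorm A * ‖Z‖ :=
  norm_dataSpace_le_of_forall (spectralNorm_nonneg A) fun i => norm_mulVec_le A (Z i)

/-- The Euclidean norm of a coordinate across the data. -/
noncomputable def coordNorm {n q : ℕ} (Z : DataSpace n q) (c : Fin q) : ℝ :=
  Real.sqrt (∑ i, Z i c ^ 2)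

lemma coordNorm_sq {n q : ℕ} (Z : DataSpace n q) (c : Fin q) :
    coordNorm Z c ^ 2 = ∑ i, Z i c ^ 2 :=
  Real.sq_sqrt (Finset.sum_nonneg fun _ _ => sq_nonneg _)

lemma coordNorm_nonneg {n q : ℕ} (Z : DataSpace n q) (c : Fin q) : 0 ≤ coordNorm Z c :=
  Real.sqrt_nonneg _

/-- The data matrix whose only non-zero column is a normalised column of `Z`. -/
noncomputable def columnAtom {n q : ℕ} (p : ℕ) (Z : DataSpace n q) (rc : Fin p × Fin q) :
    DataSpace n p :=
  WithLp.toLp 2 fun i => WithLp.toLp 2 fun r => if r = rc.1 then Z i rc.2 / coordNorm Z rc.2 else 0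

/-- Only an inequality: a vanishing column of the data is divided by 0 and gives the zero atom. -/
lemma norm_columnAtom_le {n p q : ℕ} (Z : DataSpace n q) (rc : Fin p × Fin q) :
    ‖columnAtom p Z rc‖ ≤ 1 := by
  rw [← sq_le_one_iff₀ (norm_nonneg _), dataSpace_norm_sq_entries]
  simp only [columnAtom]
  rw [Finset.sum_eq_single rc.1]
  · simp only [if_true, div_pow, ← Finset.sum_div, coordNorm_sq]
    exact div_self_le_one _
  · intro r _ hr
    simp [hr]
  · simp

/-- The `p * q` atoms depend on the data alone; the matrix enters through the coefficients. This
puts the layer within reach of `exists_cover_absConvex`. -/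
lemma mulData_eq_sum {n p q : ℕ} (B : Matrix (Fin p) (Fin q) ℝ) (Z : DataSpace n q) :
    mulData B Z =
      ∑ rc : Fin p × Fin q, (B rc.1 rc.2 * coordNorm Z rc.2) • columnAtom p Z rc := by
  ext i r
  rw [mulData_apply, Fintype.sum_prod_type]
  simp only [columnAtom, WithLp.ofLp_sum, WithLp.ofLp_smul, Finset.sum_apply, Pi.smul_apply,
    smul_eq_mul]
  rw [Finset.sum_eq_single r]
  · refine Finset.sum_congr rfl fun c _ => ?_
    simp only [if_true]
    rcases eq_or_ne (coordNorm Z c) 0 with h | h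
    · have h2 := coordNorm_sq Z c
      rw [h, zero_pow two_ne_zero, eq_comm,
        Finset.sum_eq_zero_iff_of_nonneg fun _ _ => sq_nonneg _] at h2
      have : Z i c = 0 := by simpa using h2 i (Finset.mem_univ i)
      simp [this]
    · field_simp
  · intro r' _ hr
    simp [hr.symm]
  · simp

/-- Cauchy–Schwarz in each row of `B`. Rows of `B` are columns of its transpose, which is why the
(2,1) norm is taken of transposes. -/
lemma sum_abs_mul_coordNorm_le {n p q : ℕ} (B : Matrix (Fin p) (Fin q) ℝ) (Z : DataSpace n q) :
    ∑ rc : Fin p × Fin q, |B rc.1 rc.2 * coordNorm Z rc.2| ≤ norm21 B.transpose * ‖Z‖ := by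
  rw [Fintype.sum_prod_type, norm21, Finset.sum_mul]
  refine Finset.sum_le_sum fun r _ => ?_
  have hZ : ‖Z‖ = Real.sqrt (∑ c, coordNorm Z c ^ 2) := by
    simp_rw [coordNorm_sq]
    rw [← dataSpace_norm_sq_entries, Real.sqrt_sq (norm_nonneg _)]
  simp only [abs_mul, abs_of_nonneg (coordNorm_nonneg Z _), Matrix.transpose_apply]
  have h := Real.sum_mul_le_sqrt_mul_sqrt Finset.univ (fun c => |B r c|) fun c => coordNorm Z c
  simp only [sq_abs] at h
  rw [hZ]
  exact h

/-- A cover of the outputs of a linear layer, by data of controlled norm. -/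
lemma exists_layer_cover {n p q W : ℕ} (hW : 2 ≤ W) (hp : p ≤ W) (hq : q ≤ W)
    (M : Matrix (Fin p) (Fin q) ℝ) (Z : DataSpace n q) {a s x : ℝ} (ha : 0 ≤ a) (hs : 0 ≤ s)
    (hx : 0 < x) :
    ∃ C : Finset (DataSpace n p), Real.log C.card ≤ 2 * x * Real.log (2 * W ^ 2) ∧
      (∀ c ∈ C, ‖c‖ ≤ s * ‖Z‖) ∧
      ∀ A : Matrix (Fin p) (Fin q) ℝ, spectralNorm A ≤ s →
        norm21 (A.transpose - M.transpose) ≤ a →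
          ∃ c ∈ C, ‖mulData A Z - c‖ ≤ a * ‖Z‖ / Real.sqrt x := by
  classical
  have hW' : (2 : ℝ) ≤ W := by exact_mod_cast hW
  have hp' : (p : ℝ) ≤ W := by exact_mod_cast hp
  have hq' : (q : ℝ) ≤ W := by exact_mod_cast hq
  have hN : (1 : ℝ) ≤ 2 * W ^ 2 := by nlinarith
  obtain ⟨C, hC, hcov⟩ := exists_cover_absConvex (norm_columnAtom_le (p := p) Z)
    (g := a * ‖Z‖) (by positivity) hx hN (by
      simp only [Fintype.card_prod, Fintype.card_fin]
      push_cast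
      have : (p : ℝ) * q ≤ W * W := mul_le_mul hp' hq' (by positivity) (by positivity)
      nlinarith)
  have hball : ∀ c : DataSpace n p, ∃ v ∈ Metric.closedBall (0 : DataSpace n p) (s * ‖Z‖),
      ∀ y ∈ Metric.closedBall (0 : DataSpace n p) (s * ‖Z‖), ‖y - v‖ ≤ ‖y - c‖ :=
    exists_projection (Metric.nonempty_closedBall.2 (by positivity))
      Metric.isClosed_closedBall.isComplete (convex_closedBall _ _)
  choose P hPmem hP using hball
  -- The cover of the increments `(A - M) Z` is shifted by `M Z` and projected to the ball of radius
  -- `s * ‖Z‖`. That ball contains every `A Z` of the class, so accuracy is not lost, and the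
  -- centres acquire the norm bound that the next layer needs.
  refine ⟨C.image fun c => P (mulData M Z + c), ?_, ?_, fun A hA hAM => ?_⟩
  · rcases C.eq_empty_or_nonempty with h | h
    · simpa [h] using hC
    · refine le_trans (Real.log_le_log ?_ ?_) hC
      · exact_mod_cast (h.image _).card_pos
      · exact_mod_cast Finset.card_image_le
  · intro c hc
    obtain ⟨c', -, rfl⟩ := Finset.mem_image.1 hc
    simpa using hPmem (mulData M Z + c')
  · obtain ⟨c, hc, hdist⟩ := hcov (fun rc => (A - M) rc.1 rc.2 * coordNorm Z rc.2) (by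
      refine (sum_abs_mul_coordNorm_le (A - M) Z).trans ?_
      rw [Matrix.transpose_sub]
      exact mul_le_mul_of_nonneg_right hAM (norm_nonneg _))
    refine ⟨_, Finset.mem_image_of_mem _ hc, (hP _ _ ?_).trans ?_⟩
    · simpa using (norm_mulData_le A Z).trans (mul_le_mul_of_nonneg_right hA (norm_nonneg _))
    · rw [← mulData_eq_sum, mulData_sub_matrix] at hdist
      rwa [← sub_sub]

end LayerCover

/-! ### Composition of covers through the network. -/

section NetworkCover

variable {L n : ℕ} {d : Fin (L + 1) → ℕ} {m : Fin L → ℕ}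

/-- Application of a nonlinearity to each data point. -/
noncomputable def mapData {p q : ℕ} (f : EuclideanSpace ℝ (Fin p) → EuclideanSpace ℝ (Fin q))
    (Z : DataSpace n p) : DataSpace n q :=
  WithLp.toLp 2 fun k => f (Z k)

lemma norm_mapData_sub_le {p q : ℕ} {f : EuclideanSpace ℝ (Fin p) → EuclideanSpace ℝ (Fin q)}
    {r : NNReal} (hf : LipschitzWith r f) (Y Z : DataSpace n p) :
    ‖mapData f Y - mapData f Z‖ ≤ r * ‖Y - Z‖ :=
  norm_dataSpace_le_of_forall r.2 fun k => hf.norm_sub_le (Y k) (Z k)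

lemma norm_mapData_le {p q : ℕ} {f : EuclideanSpace ℝ (Fin p) → EuclideanSpace ℝ (Fin q)}
    {r : NNReal} (hf : LipschitzWith r f) (h0 : f 0 = 0) (Z : DataSpace n p) :
    ‖mapData f Z‖ ≤ r * ‖Z‖ :=
  norm_dataSpace_le_of_forall r.2 fun k => by
    have := hf.norm_sub_le (Z k) 0
    rwa [h0, sub_zero, sub_zero] at this

/-- The output of the first `i` layers on all data points. -/
noncomputable def layerData (σ : Nonlinearities d m) (A : Weights d m)
    (X : Fin n → EuclideanSpace ℝ (Fin (d 0))) (i : Fin (L + 1)) : DataSpace n (d i) :=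
  WithLp.toLp 2 fun k => layerOutput σ A (X k) i

lemma layerOutput_succ (σ : Nonlinearities d m) (A : Weights d m)
    (x : EuclideanSpace ℝ (Fin (d 0))) (i : Fin L) :
    layerOutput σ A x i.succ =
      σ i (WithLp.toLp 2 (Matrix.mulVec (A i) (layerOutput σ A x i.castSucc))) := by
  rw [layerOutput, Fin.induction_succ]
  rfl

lemma layerData_succ (σ : Nonlinearities d m) (A : Weights d m)
    (X : Fin n → EuclideanSpace ℝ (Fin (d 0))) (i : Fin L) :
    layerData σ A X i.succ = mapData (σ i) (mulData (A i) (layerData σ A X i.castSucc)) := by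
  ext k : 1
  exact layerOutput_succ σ A (X k) i

lemma norm_layerData_zero (σ : Nonlinearities d m) (A : Weights d m)
    (X : Fin n → EuclideanSpace ℝ (Fin (d 0))) : ‖layerData σ A X 0‖ = dataNorm X := by
  rw [dataNorm, ← Real.sqrt_sq (norm_nonneg (layerData σ A X 0)), dataSpace_norm_sq]
  rfl

/-- The layers before the `i`-th intermediate output. -/
def layersBelow (i : Fin (L + 1)) : Finset (Fin L) :=
  Finset.univ.filter fun j => j.castSucc < i

lemma layersBelow_zero : layersBelow (0 : Fin (L + 1)) = ∅ := by
  simp [layersBelow]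

lemma layersBelow_last : layersBelow (Fin.last L) = Finset.univ := by
  simp [layersBelow, Fin.castSucc_lt_last]

lemma notMem_layersBelow (i : Fin L) : i ∉ layersBelow i.castSucc := by
  simp [layersBelow]

lemma layersBelow_succ (i : Fin L) :
    layersBelow i.succ = insert i (layersBelow i.castSucc) := by
  ext j
  simp only [layersBelow, Finset.mem_filter, Finset.mem_univ, true_and, Finset.mem_insert,
    Fin.lt_def, Fin.ext_iff, Fin.val_castSucc, Fin.val_succ]
  omega

/-- Weights within prescribed distances from the reference matrices and of prescribed spectral
norms. -/
def weightClass (M : Weights d m) (a s : Fin L → ℝ) : Set (Weights d m) :=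
  {A | ∀ i, spectralNorm (A i) ≤ s i ∧ norm21 ((A i).transpose - (M i).transpose) ≤ a i}

lemma card_le_exp_of_log_le {N : ℕ} {ℓ : ℝ} (h : Real.log N ≤ ℓ) : (N : ℝ) ≤ Real.exp ℓ := by
  rcases Nat.eq_zero_or_pos N with rfl | hN
  · simpa using (Real.exp_pos _).le
  · exact (Real.log_le_iff_le_exp (by exact_mod_cast hN)).1 h

/-- Nonnegativity of `ℓ` matters only for `N = 0`, where `Real.log 0 = 0`. -/
lemma log_le_of_card_le_exp {N : ℕ} {ℓ : ℝ} (hℓ : 0 ≤ ℓ) (h : (N : ℝ) ≤ Real.exp ℓ) :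
    Real.log N ≤ ℓ := by
  rcases Nat.eq_zero_or_pos N with rfl | hN
  · simpa using hℓ
  · exact (Real.log_le_iff_le_exp (by exact_mod_cast hN)).2 h

lemma layer_le_width_left (i : Fin (L + 1)) : d i ≤ width d m :=
  (Finset.le_sup (Finset.mem_univ i)).trans (le_max_left _ _)

lemma layer_le_width_right (i : Fin L) : m i ≤ width d m :=
  (Finset.le_sup (Finset.mem_univ i)).trans (le_max_right _ _)

/-- A cover of the intermediate outputs of all networks with weights in a class, obtained layer
by layer. The parameter `x j` controls the accuracy spent on layer `j`. -/
lemma exists_layerData_cover (hW : 2 ≤ width d m) {σ : Nonlinearities d m} {ρ : Fin L → NNReal}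
    (hσ : ∀ i, LipschitzWith (ρ i) (σ i)) (hσ0 : ∀ i, σ i 0 = 0) (M : Weights d m)
    {a s x : Fin L → ℝ} (ha : ∀ i, 0 ≤ a i) (hs : ∀ i, 0 < s i) (hx : ∀ i, 0 < x i)
    (X : Fin n → EuclideanSpace ℝ (Fin (d 0))) (i : Fin (L + 1)) :
    ∃ C : Finset (DataSpace n (d i)),
      (C.card : ℝ) ≤
        Real.exp (2 * (∑ j ∈ layersBelow i, x j) * Real.log (2 * (width d m : ℝ) ^ 2)) ∧
      (∀ c ∈ C, ‖c‖ ≤ (∏ j ∈ layersBelow i, ρ j * s j) * dataNorm X) ∧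
      ∀ A ∈ weightClass M a s, ∃ c ∈ C, ‖layerData σ A X i - c‖ ≤
        (∏ j ∈ layersBelow i, ρ j * s j) * dataNorm X *
          ∑ j ∈ layersBelow i, a j / (s j * Real.sqrt (x j)) := by
  classical
  induction i using Fin.induction with
  | zero =>
    refine ⟨{layerData σ M X 0}, ?_, ?_, fun A _ => ⟨_, Finset.mem_singleton_self _, ?_⟩⟩
    · simp [layersBelow_zero]
    · intro c hc
      rw [Finset.mem_singleton.1 hc, norm_layerData_zero]
      simp [layersBelow_zero]
    · have : layerData σ A X 0 = layerData σ M X 0 := rfl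
      simp [layersBelow_zero, this]
  | succ i ih =>
    obtain ⟨C, hcard, hnorm, hcov⟩ := ih
    set P := (∏ j ∈ layersBelow i.castSucc, ρ j * s j) * dataNorm X with hP
    set e := ∑ j ∈ layersBelow i.castSucc, a j / (s j * Real.sqrt (x j)) with he
    -- The next layer is covered separately over each centre `c` of the previous cover, at a cost
    -- independent of `c`; hence cardinalities multiply.
    choose D hDcard hDnorm hDcov using fun c : DataSpace n (d i.castSucc) =>
      exists_layer_cover hW (layer_le_width_right (d := d) i)
        (layer_le_width_left (m := m) i.castSucc) (M i) c (ha i) (hs i).le (hx i)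
    have hP' : (∏ j ∈ layersBelow i.succ, ρ j * s j) * dataNorm X = ρ i * s i * P := by
      rw [layersBelow_succ, Finset.prod_insert (notMem_layersBelow i), hP]
      ring
    rw [hP']
    refine ⟨C.biUnion fun c => (D c).image (mapData (σ i)), ?_, ?_, fun A hA => ?_⟩
    · have h1 : ∀ c, (((D c).image (mapData (σ i))).card : ℝ) ≤
          Real.exp (2 * x i * Real.log (2 * (width d m : ℝ) ^ 2)) := fun c => by
        refine le_trans ?_ (card_le_exp_of_log_le (hDcard c))
        exact_mod_cast Finset.card_image_le
      calc ((C.biUnion fun c => (D c).image (mapData (σ i))).card : ℝ)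
          ≤ ∑ c ∈ C, (((D c).image (mapData (σ i))).card : ℝ) := by
            exact_mod_cast Finset.card_biUnion_le
        _ ≤ ∑ c ∈ C, Real.exp (2 * x i * Real.log (2 * (width d m : ℝ) ^ 2)) :=
            Finset.sum_le_sum fun c _ => h1 c
        _ = C.card * Real.exp (2 * x i * Real.log (2 * (width d m : ℝ) ^ 2)) := by simp
        _ ≤ _ := mul_le_mul_of_nonneg_right hcard (Real.exp_pos _).le
        _ = _ := by
            rw [← Real.exp_add, layersBelow_succ, Finset.sum_insert (notMem_layersBelow i)]
            congr 1
            ring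
    · intro c hc
      obtain ⟨b, hb, hc⟩ := Finset.mem_biUnion.1 hc
      obtain ⟨y, hy, rfl⟩ := Finset.mem_image.1 hc
      refine (norm_mapData_le (hσ i) (hσ0 i) y).trans ?_
      rw [mul_assoc]
      refine mul_le_mul_of_nonneg_left ((hDnorm b y hy).trans ?_) (ρ i).2
      exact mul_le_mul_of_nonneg_left (hnorm b hb) (hs i).le
    · obtain ⟨b, hb, hbd⟩ := hcov A hA
      obtain ⟨y, hy, hyd⟩ := hDcov b (A i) (hA i).1 (hA i).2
      refine ⟨mapData (σ i) y,
        Finset.mem_biUnion.2 ⟨b, hb, Finset.mem_image_of_mem _ hy⟩, ?_⟩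
      rw [layerData_succ, layersBelow_succ, Finset.sum_insert (notMem_layersBelow i), ← he]
      -- The new error has two parts: the old error amplified by `A i`, and the error of covering `A
      -- i` on the centre `b`, whose norm is at most `P`.
      have h1 : ‖mulData (A i) (layerData σ A X i.castSucc) - mulData (A i) b‖ ≤
          s i * (P * e) := by
        rw [← mulData_sub]
        exact (norm_mulData_le _ _).trans
          (mul_le_mul (hA i).1 hbd (norm_nonneg _) (hs i).le)
      have h2 : ‖mulData (A i) b - y‖ ≤ a i * P / Real.sqrt (x i) :=
        hyd.trans (div_le_div_of_nonneg_right
          (mul_le_mul_of_nonneg_left (hnorm b hb) (ha i)) (Real.sqrt_nonneg _))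
      have h3 : ‖mulData (A i) (layerData σ A X i.castSucc) - y‖ ≤
          s i * (P * e) + a i * P / Real.sqrt (x i) := by
        refine le_trans ?_ (add_le_add h1 h2)
        refine le_trans (le_of_eq ?_) (norm_add_le _ _)
        congr 1
        abel
      refine (norm_mapData_sub_le (hσ i) _ _).trans
        ((mul_le_mul_of_nonneg_left h3 (ρ i).2).trans (le_of_eq ?_))
      have := (hs i).ne'
      have := (Real.sqrt_pos.2 (hx i)).ne'
      change (ρ i : ℝ) * _ = _
      field_simp
      ring

/-- The network on all data points. -/
noncomputable def networkData (σ : Nonlinearities d m) (A : Weights d m)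
    (X : Fin n → EuclideanSpace ℝ (Fin (d 0))) : DataSpace n (d (Fin.last L)) :=
  WithLp.toLp 2 fun k => network σ A (X k)

/-- The sum `∑ᵢ (aᵢ ∏_{j ≠ i} sⱼ)^{2/3}`. -/
noncomputable def complexitySum (a s : Fin L → ℝ) : ℝ :=
  ∑ i, (a i * ∏ j ∈ Finset.univ.erase i, s j) ^ (2 / 3 : ℝ)

lemma complexitySum_nonneg {a s : Fin L → ℝ} (ha : ∀ i, 0 ≤ a i) (hs : ∀ i, 0 ≤ s i) :
    0 ≤ complexitySum a s :=
  Finset.sum_nonneg fun i _ => Real.rpow_nonneg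
    (mul_nonneg (ha i) (Finset.prod_nonneg fun j _ => hs j)) _

/-- The metric entropy of a class of networks on a data set. -/
lemma exists_networkData_cover (hL : 1 ≤ L) (hW : 2 ≤ width d m) {σ : Nonlinearities d m}
    {ρ : Fin L → NNReal}
    (hσ : ∀ i, LipschitzWith (ρ i) (σ i)) (hσ0 : ∀ i, σ i 0 = 0) (M : Weights d m)
    {a s : Fin L → ℝ} (ha : ∀ i, 0 < a i) (hs : ∀ i, 0 < s i)
    (X : Fin n → EuclideanSpace ℝ (Fin (d 0))) {T : ℝ} (hT : 0 < T)
    (hTX : (∏ i, (ρ i : ℝ)) * dataNorm X ≤ T) {ε : ℝ} (hε : 0 < ε) :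
    ∃ C : Finset (DataSpace n (d (Fin.last L))),
      Real.log C.card ≤
        2 * Real.log (2 * (width d m : ℝ) ^ 2) * T ^ 2 * complexitySum a s ^ 3 / ε ^ 2 ∧
      ∀ A ∈ weightClass M a s, ∃ c ∈ C, ‖networkData σ A X - c‖ ≤ ε := by
  obtain ⟨u, hudef⟩ : ∃ u : Fin L → ℝ, ∀ i, u i = a i * ∏ j ∈ Finset.univ.erase i, s j :=
    ⟨_, fun _ => rfl⟩
  have hu : ∀ i, 0 < u i := fun i => by
    rw [hudef]
    exact mul_pos (ha i) (Finset.prod_pos fun j _ => hs j)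
  set U := complexitySum a s with hUdef
  have hUeq : U = ∑ i, u i ^ (2 / 3 : ℝ) := by
    simp_rw [hudef]
    rfl
  have hU : 0 < U := by
    rw [hUeq]
    exact Finset.sum_pos (fun i _ => Real.rpow_pos_of_pos (hu i) _) ⟨⟨0, hL⟩, Finset.mem_univ _⟩
  -- The accuracy parameters are `x i = (c * u i ^ (1/3)) ^ 2`. Minimising `∑ x i` with `∑ u i / √(x
  -- i)` prescribed forces `x i` proportional to `u i ^ (2/3)`. Then the cost is `c ^ 2 * U` and the
  -- error at most `T * U / c`, so this `c` gives accuracy `ε`.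
  set c := T * U / ε with hc
  have hcpos : 0 < c := by positivity
  have hx : ∀ i, 0 < (c * u i ^ (1 / 3 : ℝ)) ^ 2 := fun i => by
    have := Real.rpow_pos_of_pos (hu i) (1 / 3 : ℝ)
    positivity
  have hW' : (2 : ℝ) ≤ width d m := by exact_mod_cast hW
  have hlog : 0 ≤ Real.log (2 * (width d m : ℝ) ^ 2) := Real.log_nonneg (by nlinarith)
  obtain ⟨C, hcard, -, hcov⟩ := exists_layerData_cover hW hσ hσ0 M (fun i => (ha i).le) hs hx X
    (Fin.last L)
  rw [layersBelow_last] at hcard hcov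
  refine ⟨C, ?_, fun A hA => ?_⟩
  · have e : 2 * (∑ i, (c * u i ^ (1 / 3 : ℝ)) ^ 2) * Real.log (2 * (width d m : ℝ) ^ 2) =
        2 * Real.log (2 * (width d m : ℝ) ^ 2) * T ^ 2 * U ^ 3 / ε ^ 2 := by
      have h1 : ∀ i, (c * u i ^ (1 / 3 : ℝ)) ^ 2 = c ^ 2 * u i ^ (2 / 3 : ℝ) := fun i => by
        rw [mul_pow, ← Real.rpow_natCast (u i ^ (1 / 3 : ℝ)), ← Real.rpow_mul (hu i).le]
        norm_num
      simp_rw [h1, ← Finset.mul_sum, ← hUeq, hc]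
      field_simp
    rw [e] at hcard
    exact log_le_of_card_le_exp (by positivity) hcard
  · obtain ⟨y, hy, hd⟩ := hcov A hA
    refine ⟨y, hy, hd.trans ?_⟩
    have hPs : 0 < ∏ j, s j := Finset.prod_pos fun j _ => hs j
    have h1 : ∀ i, a i / (s i * Real.sqrt ((c * u i ^ (1 / 3 : ℝ)) ^ 2)) =
        (1 / ((∏ j, s j) * c)) * u i ^ (2 / 3 : ℝ) := by
      intro i
      have hu3 := Real.rpow_pos_of_pos (hu i) (1 / 3 : ℝ)
      have hui : u i ^ (2 / 3 : ℝ) * u i ^ (1 / 3 : ℝ) = a i * ∏ j ∈ Finset.univ.erase i, s j := by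
        rw [← Real.rpow_add (hu i), ← hudef]
        norm_num
      have hprod := Finset.mul_prod_erase Finset.univ s (Finset.mem_univ i)
      have hPe : 0 < ∏ j ∈ Finset.univ.erase i, s j := Finset.prod_pos fun j _ => hs j
      rw [Real.sqrt_sq (by positivity), ← hprod]
      have := hs i
      field_simp
      linarith
    simp_rw [h1, ← Finset.mul_sum, ← hUeq]
    rw [Finset.prod_mul_distrib, hc]
    have e : ((∏ i, (ρ i : ℝ)) * ∏ i, s i) * dataNorm X * (1 / ((∏ j, s j) * (T * U / ε)) * U) =
        ((∏ i, (ρ i : ℝ)) * dataNorm X) * (ε / T) := by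
      field_simp
    rw [e]
    calc _ ≤ T * (ε / T) := mul_le_mul_of_nonneg_right hTX (by positivity)
      _ = ε := by field_simp

end NetworkCover

/-! ### Massart's lemma and Dudley's chaining. -/

section Chaining

variable {ι : Type*} [Finite ι] [Nonempty ι] {n : ℕ}

lemma signAvg_add_le (v w : ι → Fin n → ℝ) :
    signAvg (fun i k => v i k + w i k) ≤ signAvg v + signAvg w := by
  rw [signAvg, signAvg, signAvg, ← mul_add, ← Finset.sum_add_distrib]
  refine mul_le_mul_of_nonneg_left (Finset.sum_le_sum fun s _ => ciSup_le fun i => ?_)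
    (by positivity)
  simp_rw [mul_add, Finset.sum_add_distrib]
  exact add_le_add
    (le_ciSup (f := fun i => ∑ k, boolSign (s k) * v i k) (Set.finite_range _).bddAbove i)
    (le_ciSup (f := fun i => ∑ k, boolSign (s k) * w i k) (Set.finite_range _).bddAbove i)

lemma signAvg_le_sqrt_mul {ι : Type*} [Nonempty ι] {v : ι → EuclideanSpace ℝ (Fin n)} {r : ℝ} (h : ∀ i, ‖v i‖ ≤ r) :
    signAvg (fun i k => v i k) ≤ Real.sqrt n * r := by
  rw [signAvg, ← sum_signs_const (n := n) (Real.sqrt n * r)]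
  refine mul_le_mul_of_nonneg_left (Finset.sum_le_sum fun s _ => ciSup_le fun i => ?_)
    (by positivity)
  have h1 := Real.sum_mul_le_sqrt_mul_sqrt Finset.univ (fun k => boolSign (s k)) fun k => v i k
  have h2 : ∀ k, boolSign (s k) ^ 2 = 1 := fun k => by rw [← sq_abs, abs_boolSign, one_pow]
  have h3 : ‖v i‖ = Real.sqrt (∑ k, v i k ^ 2) := by
    rw [EuclideanSpace.norm_eq]
    simp
  simp only [h2, Finset.sum_const, Finset.card_univ, Fintype.card_fin, nsmul_eq_mul, mul_one,
    ← h3] at h1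
  exact h1.trans (mul_le_mul_of_nonneg_left (h i) (Real.sqrt_nonneg _))

/-- The average over independent signs factors into a product of `cosh (u k)`, each at most `exp (u
k ^ 2 / 2)`. -/
lemma avg_exp_sum_le (u : Fin n → ℝ) :
    (2 ^ n : ℝ)⁻¹ * ∑ s : Fin n → Bool, Real.exp (∑ k, boolSign (s k) * u k) ≤
      Real.exp ((∑ k, u k ^ 2) / 2) := by
  have e : ∑ s : Fin n → Bool, Real.exp (∑ k, boolSign (s k) * u k) =
      ∏ k, (2 * Real.cosh (u k)) := by
    have h := Finset.prod_univ_sum (fun _ : Fin n => (Finset.univ : Finset Bool))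
      fun k b => Real.exp (boolSign b * u k)
    rw [Fintype.piFinset_univ] at h
    simp_rw [Real.exp_sum]
    rw [← h]
    refine Finset.prod_congr rfl fun k _ => ?_
    simp only [Fintype.sum_bool, boolSign, Real.cosh_eq]
    norm_num
    ring
  rw [e, Finset.prod_mul_distrib]
  simp only [Finset.prod_const, Finset.card_univ, Fintype.card_fin]
  rw [inv_mul_cancel_left₀ (by positivity), Finset.sum_div, Real.exp_sum]
  exact Finset.prod_le_prod (fun k _ => (Real.cosh_pos _).le) fun k _ => Real.cosh_le_exp_half_sq _

/-- **Massart's lemma**. -/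
lemma signAvg_le_of_mem_finset {v : ι → EuclideanSpace ℝ (Fin n)}
    {C : Finset (EuclideanSpace ℝ (Fin n))} (hv : ∀ i, v i ∈ C) {r ℓ : ℝ} (hr : 0 ≤ r)
    (h : ∀ i, ‖v i‖ ≤ r) (hC : Real.log C.card ≤ ℓ) :
    signAvg (fun i k => v i k) ≤ r * Real.sqrt (2 * ℓ) := by
  classical
  obtain ⟨i₀⟩ := ‹Nonempty ι›
  have : Nonempty ι := ⟨i₀⟩
  have hpos : (0 : ℝ) < C.card := by exact_mod_cast Finset.card_pos.2 ⟨_, hv i₀⟩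
  have hℓ : 0 ≤ ℓ := le_trans (Real.log_natCast_nonneg _) hC
  set a := signAvg (fun i k => v i k) with ha
  -- Jensen moves the exponential inside the average, and the supremum is bounded by a sum over the
  -- points of `C` with norm at most `r`; other points of `C` are irrelevant. The best choice is `t
  -- = a / r ^ 2`.
  have hmain : ∀ t : ℝ, 0 ≤ t → t * a ≤ ℓ + t ^ 2 * r ^ 2 / 2 := by
    intro t ht
    have h1 : Real.exp (t * a) ≤ (2 ^ n : ℝ)⁻¹ * ∑ s : Fin n → Bool,
        Real.exp (t * ⨆ i, ∑ k, boolSign (s k) * v i k) := by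
      have hJ := convexOn_exp.map_sum_le (t := (Finset.univ : Finset (Fin n → Bool)))
        (w := fun _ => (2 ^ n : ℝ)⁻¹)
        (p := fun s => t * ⨆ i, ∑ k, boolSign (s k) * v i k) (fun _ _ => by positivity)
        (by have := sum_signs_const (n := n) 1; rw [Finset.mul_sum] at this; simp)
        (fun _ _ => Set.mem_univ _)
      simp only [smul_eq_mul, ← Finset.mul_sum] at hJ
      refine le_trans (le_of_eq ?_) hJ
      rw [ha, signAvg]
      congr 1
      ring
    have h2 : ∀ s : Fin n → Bool, Real.exp (t * ⨆ i, ∑ k, boolSign (s k) * v i k) ≤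
        ∑ u ∈ C.filter (fun u => ‖u‖ ≤ r), Real.exp (∑ k, boolSign (s k) * (t * u k)) := by
      intro s
      obtain ⟨i, hi⟩ := exists_eq_ciSup_of_finite (f := fun i => ∑ k, boolSign (s k) * v i k)
      rw [← hi]
      have e : t * ∑ k, boolSign (s k) * v i k = ∑ k, boolSign (s k) * (t * v i k) := by
        rw [Finset.mul_sum]
        exact Finset.sum_congr rfl fun k _ => by ring
      rw [e]
      exact Finset.single_le_sum
        (f := fun u : EuclideanSpace ℝ (Fin n) => Real.exp (∑ k, boolSign (s k) * (t * u k)))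
        (fun u _ => (Real.exp_pos _).le) (Finset.mem_filter.2 ⟨hv i, h i⟩)
    have h3 : Real.exp (t * a) ≤ C.card * Real.exp (t ^ 2 * r ^ 2 / 2) := by
      calc _ ≤ (2 ^ n : ℝ)⁻¹ * ∑ s : Fin n → Bool, ∑ u ∈ C.filter (fun u => ‖u‖ ≤ r),
            Real.exp (∑ k, boolSign (s k) * (t * u k)) :=
            h1.trans (mul_le_mul_of_nonneg_left (Finset.sum_le_sum fun s _ => h2 s)
              (by positivity))
        _ = ∑ u ∈ C.filter (fun u => ‖u‖ ≤ r), (2 ^ n : ℝ)⁻¹ * ∑ s : Fin n → Bool,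
            Real.exp (∑ k, boolSign (s k) * (t * u k)) := by
            rw [Finset.sum_comm, Finset.mul_sum]
        _ ≤ ∑ u ∈ C.filter (fun u => ‖u‖ ≤ r), Real.exp (t ^ 2 * r ^ 2 / 2) := by
            refine Finset.sum_le_sum fun u hu => (avg_exp_sum_le fun k => t * u k).trans ?_
            refine Real.exp_le_exp.2 (div_le_div_of_nonneg_right ?_ zero_le_two)
            simp_rw [mul_pow, ← Finset.mul_sum]
            refine mul_le_mul_of_nonneg_left ?_ (sq_nonneg t)
            have h4 : ‖u‖ ^ 2 = ∑ k, u k ^ 2 := by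
              rw [EuclideanSpace.norm_sq_eq]
              simp
            rw [← h4]
            exact pow_le_pow_left₀ (norm_nonneg _) (Finset.mem_filter.1 hu).2 2
        _ ≤ ∑ u ∈ C, Real.exp (t ^ 2 * r ^ 2 / 2) :=
            Finset.sum_le_sum_of_subset_of_nonneg (Finset.filter_subset _ _)
              fun _ _ _ => (Real.exp_pos _).le
        _ = _ := by simp
    have h4 := Real.log_le_log (Real.exp_pos _) h3
    rw [Real.log_exp, Real.log_mul hpos.ne' (Real.exp_pos _).ne', Real.log_exp] at h4
    linarith
  rcases le_or_gt a 0 with ha0 | ha0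
  · exact ha0.trans (by positivity)
  · rcases hr.eq_or_lt with hr0 | hr0
    -- For `r = 0` the quadratic term is absent, and this `t` would give `ℓ + 1 ≤ ℓ`.
    · have := hmain ((ℓ + 1) / a) (by positivity)
      rw [← hr0, div_mul_cancel₀ _ ha0.ne'] at this
      norm_num at this
    · have := hmain (a / r ^ 2) (by positivity)
      have h5 : a ^ 2 ≤ r ^ 2 * (2 * ℓ) := by
        have e1 : a / r ^ 2 * a = a ^ 2 / r ^ 2 := by ring
        have e2 : (a / r ^ 2) ^ 2 * r ^ 2 / 2 = a ^ 2 / r ^ 2 / 2 := by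
          field_simp
        rw [e1, e2] at this
        have h6 : a ^ 2 / r ^ 2 ≤ 2 * ℓ := by linarith
        rw [div_le_iff₀ (by positivity)] at h6
        linarith
      calc a ≤ Real.sqrt (r ^ 2 * (2 * ℓ)) := Real.le_sqrt_of_sq_le h5
        _ = r * Real.sqrt (2 * ℓ) := by rw [Real.sqrt_mul (by positivity), Real.sqrt_sq hr]

/-- Dudley's chaining bound for a class whose metric entropy at scale `ε` is at most
`K ^ 2 / ε ^ 2`. -/
lemma signAvg_le_chaining (hn : 0 < n) {v : ι → EuclideanSpace ℝ (Fin n)}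
    (hv : ∀ i, ‖v i‖ ≤ Real.sqrt n) {K : ℝ} (hK : 0 ≤ K)
    (hcov : ∀ ε : ℝ, 0 < ε → ∃ C : Finset (EuclideanSpace ℝ (Fin n)),
      Real.log C.card ≤ K ^ 2 / ε ^ 2 ∧ ∀ i, ∃ c ∈ C, ‖v i - c‖ ≤ ε) (J : ℕ) :
    signAvg (fun i k => v i k) ≤ n / 2 ^ J + 6 * K * J := by
  classical
  have hn' : (0 : ℝ) < n := by exact_mod_cast hn
  have hsn : 0 < Real.sqrt n := Real.sqrt_pos.2 hn'
  -- The coarsest scale is the radius of the class, so level 0 is covered by the origin alone.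
  let ε : ℕ → ℝ := fun j => Real.sqrt n / 2 ^ j
  have hε : ∀ j, 0 < ε j := fun j => by positivity
  have hεs : ∀ j, ε j = 2 * ε (j + 1) := fun j => by
    simp only [ε, pow_succ]; field_simp
  have hchain : ∀ j, ∃ (C : Finset (EuclideanSpace ℝ (Fin n)))
      (π : ι → EuclideanSpace ℝ (Fin n)), Real.log C.card ≤ K ^ 2 / ε j ^ 2 ∧
        (∀ i, π i ∈ C) ∧ (∀ i, ‖v i - π i‖ ≤ ε j) ∧ (j = 0 → ∀ i, π i = 0) := by
    intro j
    rcases Nat.eq_zero_or_pos j with rfl | hj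
    · exact ⟨{0}, fun _ => 0, by simpa using by positivity, by simp, fun i => by
        simpa [ε] using hv i, fun _ _ => rfl⟩
    · obtain ⟨C, hC, hc⟩ := hcov (ε j) (hε j)
      choose π hπ hd using hc
      exact ⟨C, π, hC, hπ, hd, fun h => by omega⟩
  choose C π hC hπ hd hzero using hchain
  -- A link of the chain has norm at most `ε j + ε (j + 1) = 3 ε (j + 1)` and log-cardinality at
  -- most `2 K ^ 2 / ε (j + 1) ^ 2`. Massart then gives `6 K`, independent of the scale.
  have hstep : ∀ j, signAvg (fun i k => (v i - π j i) k) ≤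
      signAvg (fun i k => (v i - π (j + 1) i) k) + 6 * K := by
    intro j
    have e : (fun i k => (v i - π j i) k) = fun i k =>
        (v i - π (j + 1) i) k + (π (j + 1) i - π j i) k := by
      ext i k
      simp
    rw [e]
    refine (signAvg_add_le _ _).trans (add_le_add_right ?_ _)
    have hne : ∀ j, 0 < (C j).card := fun j =>
      Finset.card_pos.2 ⟨_, hπ j (Classical.arbitrary ι)⟩
    have hmass := signAvg_le_of_mem_finset (v := fun i => π (j + 1) i - π j i)
      (C := Finset.image₂ (fun x y => x - y) (C (j + 1)) (C j))
      (fun i => Finset.mem_image₂_of_mem (hπ _ i) (hπ _ i)) (r := 3 * ε (j + 1))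
      (ℓ := 2 * (K ^ 2 / ε (j + 1) ^ 2)) (by have := hε (j + 1); positivity)
      (fun i => by
        have h1 := hd j i
        have h2 := hd (j + 1) i
        rw [hεs j] at h1
        rw [norm_sub_rev] at h2
        calc ‖π (j + 1) i - π j i‖ = ‖(π (j + 1) i - v i) + (v i - π j i)‖ := by congr 1; abel
          _ ≤ _ := norm_add_le _ _
          _ ≤ _ := by linarith)
      (by
        have hcard : ((Finset.image₂ (fun x y => x - y) (C (j + 1)) (C j)).card : ℝ) ≤
            (C (j + 1)).card * (C j).card := by exact_mod_cast Finset.card_image₂_le _ _ _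
        have hpos : 0 < (Finset.image₂ (fun x y => x - y) (C (j + 1)) (C j)).card :=
          Finset.card_pos.2 ((Finset.card_pos.1 (hne _)).image₂ (Finset.card_pos.1 (hne _)))
        have h1 : (0 : ℝ) < (C (j + 1)).card := by exact_mod_cast hne (j + 1)
        have h2 : (0 : ℝ) < (C j).card := by exact_mod_cast hne j
        have h3 := Real.log_le_log (by exact_mod_cast hpos) hcard
        rw [Real.log_mul h1.ne' h2.ne'] at h3
        have h4 : K ^ 2 / ε j ^ 2 ≤ K ^ 2 / ε (j + 1) ^ 2 := by
          have := hε (j + 1)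
          refine div_le_div_of_nonneg_left (sq_nonneg K) (by positivity) ?_
          exact pow_le_pow_left₀ this.le (by rw [hεs j]; linarith) 2
        linarith [hC j, hC (j + 1)])
    refine hmass.trans (le_of_eq ?_)
    have h1 : 2 * (2 * (K ^ 2 / ε (j + 1) ^ 2)) = (2 * K / ε (j + 1)) ^ 2 := by ring
    have h2 := hε (j + 1)
    rw [h1, Real.sqrt_sq (by positivity)]
    field_simp
    ring
  have hind : ∀ J : ℕ, signAvg (fun i k => v i k) ≤
      signAvg (fun i k => (v i - π J i) k) + 6 * K * J := by
    intro J
    induction J with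
    | zero =>
      simp [hzero 0 rfl]
    | succ J ih =>
      push_cast
      linarith [hstep J]
  refine (hind J).trans (add_le_add_left ?_ _)
  refine (signAvg_le_sqrt_mul (hd J)).trans (le_of_eq ?_)
  simp only [ε]
  rw [← mul_div_assoc, Real.mul_self_sqrt hn'.le]

end Chaining

/-! ### Lipschitz properties of the ramp loss of the margin. -/

section Loss

lemma ramp_eq {γ : ℝ} (hγ : 0 < γ) (r : ℝ) : ramp γ r = max 0 (min 1 (1 + r / γ)) := by
  unfold ramp
  split_ifs with h1 h2
  · have : r / γ < -1 := by rw [div_lt_iff₀ hγ]; linarith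
    rw [max_eq_left]
    exact (min_le_right _ _).trans (by linarith)
  · have h3 : -1 ≤ r / γ := by rw [le_div_iff₀ hγ]; linarith
    have h4 : r / γ ≤ 0 := div_nonpos_of_nonpos_of_nonneg h2 hγ.le
    rw [min_eq_right (by linarith), max_eq_right (by linarith)]
  · have : 0 < r / γ := div_pos (by linarith) hγ
    rw [min_eq_left (by linarith), max_eq_right zero_le_one]

lemma ramp_nonneg {γ : ℝ} (hγ : 0 < γ) (r : ℝ) : 0 ≤ ramp γ r := by
  rw [ramp_eq hγ]
  exact le_max_left _ _

lemma ramp_le_one {γ : ℝ} (hγ : 0 < γ) (r : ℝ) : ramp γ r ≤ 1 := by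
  rw [ramp_eq hγ]
  exact max_le zero_le_one (min_le_left _ _)

lemma ramp_eq_one {γ r : ℝ} (hγ : 0 < γ) (hr : 0 ≤ r) : ramp γ r = 1 := by
  have : 0 ≤ r / γ := by positivity
  rw [ramp_eq hγ, min_eq_left (by linarith), max_eq_right zero_le_one]

/-- For negative `r` the quotient `r / γ` increases with `γ`. This allows a margin to be rounded
down to the grid. -/
lemma ramp_mono_left {γ γ' : ℝ} (hγ' : 0 < γ') (h : γ' ≤ γ) (r : ℝ) : ramp γ' r ≤ ramp γ r := by
  have hγ : 0 < γ := hγ'.trans_le h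
  rcases le_or_gt 0 r with hr | hr
  · rw [ramp_eq_one hγ' hr, ramp_eq_one hγ hr]
  · rw [ramp_eq hγ, ramp_eq hγ']
    refine max_le_max le_rfl (min_le_min le_rfl (add_le_add le_rfl ?_))
    rw [div_le_div_iff₀ hγ' hγ]
    nlinarith

lemma abs_ramp_sub_le {γ : ℝ} (hγ : 0 < γ) (r t : ℝ) :
    |ramp γ r - ramp γ t| ≤ |r - t| / γ := by
  rw [ramp_eq hγ, ramp_eq hγ]
  have h1 := abs_max_sub_max_le_abs (min 1 (1 + r / γ)) (min 1 (1 + t / γ)) 0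
  have h2 := abs_min_sub_min_le_max 1 (1 + r / γ) 1 (1 + t / γ)
  rw [max_comm 0, max_comm 0]
  refine h1.trans (h2.trans (max_le (by simpa using by positivity) (le_of_eq ?_)))
  rw [add_sub_add_left_eq_sub, ← sub_div, abs_div, abs_of_pos hγ]

lemma abs_apply_sub_le {k : ℕ} (v w : EuclideanSpace ℝ (Fin k)) (j : Fin k) :
    |v j - w j| ≤ ‖v - w‖ := by
  have := PiLp.norm_apply_le (v - w) j
  simpa using this

lemma nonempty_ne {k : ℕ} (hk : 2 ≤ k) (y : Fin k) : Nonempty {j : Fin k // j ≠ y} := by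
  have : Nontrivial (Fin k) := Fin.nontrivial_iff_two_le.2 hk
  obtain ⟨j, hj⟩ := exists_ne y
  exact ⟨⟨j, hj⟩⟩

/-- The score of the true label and the largest competing score each move by at most `‖v - w‖`. -/
lemma abs_margin_sub_le {k : ℕ} (hk : 2 ≤ k) (v w : EuclideanSpace ℝ (Fin k)) (y : Fin k) :
    |margin v y - margin w y| ≤ 2 * ‖v - w‖ := by
  have := nonempty_ne hk y
  have h1 := abs_apply_sub_le v w y
  have h2 := abs_ciSup_sub_ciSup_le (a := fun j : {j : Fin k // j ≠ y} => v j)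
    (b := fun j : {j : Fin k // j ≠ y} => w j) fun j => abs_apply_sub_le v w j
  unfold margin
  rw [abs_le] at *
  constructor <;> linarith

lemma abs_ramp_margin_sub_le {k : ℕ} (hk : 2 ≤ k) {γ : ℝ} (hγ : 0 < γ)
    (v w : EuclideanSpace ℝ (Fin k)) (y : Fin k) :
    |ramp γ (-margin v y) - ramp γ (-margin w y)| ≤ 2 / γ * ‖v - w‖ := by
  refine (abs_ramp_sub_le hγ _ _).trans ?_
  rw [neg_sub_neg, abs_sub_comm, div_mul_eq_mul_div]
  exact div_le_div_of_nonneg_right (abs_margin_sub_le hk v w y) hγ.le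

/-- The vector of ramp losses of a matrix of scores. -/
noncomputable def lossVec {n k : ℕ} (γ : ℝ) (y : Fin n → Fin k) (Z : DataSpace n k) :
    EuclideanSpace ℝ (Fin n) :=
  WithLp.toLp 2 fun i => ramp γ (-margin (Z i) (y i))

lemma norm_lossVec_sub_le {n k : ℕ} (hk : 2 ≤ k) {γ : ℝ} (hγ : 0 < γ) (y : Fin n → Fin k)
    (Y Z : DataSpace n k) : ‖lossVec γ y Y - lossVec γ y Z‖ ≤ 2 / γ * ‖Y - Z‖ := by
  refine le_of_sq_le_sq ?_ (by positivity)
  rw [mul_pow, dataSpace_norm_sq, EuclideanSpace.norm_sq_eq, Finset.mul_sum]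
  refine Finset.sum_le_sum fun i _ => ?_
  rw [← mul_pow]
  exact pow_le_pow_left₀ (norm_nonneg _) (abs_ramp_margin_sub_le hk hγ (Y i) (Z i) (y i)) 2

lemma norm_lossVec_le {n k : ℕ} {γ : ℝ} (hγ : 0 < γ) (y : Fin n → Fin k)
    (Z : DataSpace n k) : ‖lossVec γ y Z‖ ≤ Real.sqrt n := by
  refine Real.le_sqrt_of_sq_le ?_
  rw [EuclideanSpace.norm_sq_eq]
  calc _ ≤ ∑ _i : Fin n, (1 : ℝ) := by
        refine Finset.sum_le_sum fun i _ => pow_le_one₀ (norm_nonneg _) ?_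
        rw [Real.norm_eq_abs, lossVec, abs_of_nonneg (ramp_nonneg hγ _)]
        exact ramp_le_one hγ _
    _ = n := by simp

end Loss

/-! ### Rademacher complexity of a class of networks. -/

section Rademacher

variable {L n : ℕ} {d : Fin (L + 1) → ℕ} {m : Fin L → ℕ}

/-- Uses `log 2 ≥ 2 / 3`, so that `log₂ n ≤ (3 / 2) log n`, and `log (2 * W) ≥ log 4 ≥ 1`, so that
the square root is at most `2 log (2 * W)`. -/
lemma natLog_mul_sqrt_le {W : ℕ} (hW : 2 ≤ W) (hn : 0 < n) :
    24 * (Nat.log 2 n : ℝ) * Real.sqrt (2 * Real.log (2 * (W : ℝ) ^ 2)) ≤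
      72 * Real.log n * Real.log (2 * W) := by
  have hW' : (2 : ℝ) ≤ W := by exact_mod_cast hW
  have hn' : (1 : ℝ) ≤ n := by exact_mod_cast hn
  have hl2 := Real.log_two_gt_d9
  have hw : 1 ≤ Real.log (2 * W) := by
    have h4 : Real.log 4 = 2 * Real.log 2 := by
      rw [show (4 : ℝ) = 2 ^ 2 by norm_num, Real.log_pow]; norm_num
    have : Real.log 4 ≤ Real.log (2 * W) := Real.log_le_log (by norm_num) (by linarith)
    linarith
  have hsqrt : Real.sqrt (2 * Real.log (2 * (W : ℝ) ^ 2)) ≤ 2 * Real.log (2 * W) := by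
    rw [Real.sqrt_le_left (by positivity)]
    have h1 : Real.log (2 * (W : ℝ) ^ 2) ≤ 2 * Real.log (2 * W) := by
      rw [show 2 * Real.log (2 * W) = Real.log ((2 * W) ^ 2) by rw [Real.log_pow]; norm_num]
      exact Real.log_le_log (by positivity) (by nlinarith)
    nlinarith
  have hJ : (Nat.log 2 n : ℝ) * Real.log 2 ≤ Real.log n := by
    rw [← Real.log_pow]
    refine Real.log_le_log (by positivity) ?_
    exact_mod_cast Nat.pow_log_le_self 2 hn.ne'
  have hJ0 : (0 : ℝ) ≤ Nat.log 2 n := Nat.cast_nonneg _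
  have h48 : 48 * (Nat.log 2 n : ℝ) ≤ 72 * Real.log n := by nlinarith
  calc _ ≤ 24 * (Nat.log 2 n : ℝ) * (2 * Real.log (2 * W)) :=
        mul_le_mul_of_nonneg_left hsqrt (by positivity)
    _ = 48 * (Nat.log 2 n : ℝ) * Real.log (2 * W) := by ring
    _ ≤ _ := mul_le_mul_of_nonneg_right h48 (by linarith)

lemma sqrt_pow_three {U : ℝ} (hU : 0 ≤ U) : Real.sqrt (U ^ 3) = U ^ (3 / 2 : ℝ) := by
  rw [Real.sqrt_eq_rpow, ← Real.rpow_natCast, ← Real.rpow_mul hU]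
  norm_num

lemma le_add_mul_of_forall_pos {a b c t : ℝ} (hc : 0 ≤ c)
    (h : ∀ η, 0 < η → a ≤ b + c * (t + η)) : a ≤ b + c * t := by
  by_contra! hlt
  have := h ((a - (b + c * t)) / (2 * (c + 1))) (div_pos (by linarith) (by linarith))
  have e : c * (t + (a - (b + c * t)) / (2 * (c + 1))) =
      c * t + (c / (c + 1)) * ((a - (b + c * t)) / 2) := by
    field_simp
  have h1 : c / (c + 1) ≤ 1 := (div_le_one (by linarith)).2 (by linarith)
  rw [e] at this
  nlinarith [mul_le_mul_of_nonneg_right h1 (by linarith : 0 ≤ (a - (b + c * t)) / 2)]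

/-- The empirical Rademacher complexity of the ramp losses of a finite family of networks. -/
lemma signAvg_network_le (hL : 1 ≤ L) (hk : 2 ≤ d (Fin.last L)) {σ : Nonlinearities d m}
    {ρ : Fin L → NNReal} (hσ : ∀ i, LipschitzWith (ρ i) (σ i)) (hσ0 : ∀ i, σ i 0 = 0)
    (M : Weights d m) {a s : Fin L → ℝ} (ha : ∀ i, 0 < a i) (hs : ∀ i, 0 < s i)
    {ι : Type*} [Finite ι] [Nonempty ι] {A : ι → Weights d m} (hA : ∀ i, A i ∈ weightClass M a s)
    {γ : ℝ} (hγ : 0 < γ) (hn : 0 < n) (X : Fin n → EuclideanSpace ℝ (Fin (d 0)))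
    (y : Fin n → Fin (d (Fin.last L))) :
    2 / n * signAvg (fun i k => ramp γ (-margin (network σ (A i) (X k)) (y k))) ≤
      8 / n + 72 * Real.log n * Real.log (2 * width d m) / (γ * n) *
        complexitySum a s ^ (3 / 2 : ℝ) * ((∏ i, (ρ i : ℝ)) * dataNorm X) := by
  classical
  have hW : 2 ≤ width d m := hk.trans (layer_le_width_left _)
  have hW' : (2 : ℝ) ≤ width d m := by exact_mod_cast hW
  have hn' : (0 : ℝ) < n := by exact_mod_cast hn
  set U := complexitySum a s
  have hU : 0 ≤ U := complexitySum_nonneg (fun i => (ha i).le) fun i => (hs i).le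
  set N := Real.log (2 * (width d m : ℝ) ^ 2)
  have hN : 0 ≤ N := Real.log_nonneg (by nlinarith)
  have hlogn : 0 ≤ Real.log n := Real.log_natCast_nonneg n
  have hlogW : 0 ≤ Real.log (2 * width d m) := Real.log_nonneg (by linarith)
  have hB : 0 ≤ (∏ i, (ρ i : ℝ)) * dataNorm X :=
    mul_nonneg (Finset.prod_nonneg fun i _ => (ρ i).2) (Real.sqrt_nonneg _)
  refine le_add_mul_of_forall_pos (by positivity) fun η hη => ?_
  -- The entropy bound needs a positive scale, but the data or a Lipschitz constant may vanish;
  -- hence the slack `η`, removed by `le_add_mul_of_forall_pos`.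
  set T := (∏ i, (ρ i : ℝ)) * dataNorm X + η with hT
  have hTpos : 0 < T := by linarith
  -- The losses are `2 / γ`-Lipschitz in the outputs, so covering them at scale `ε` needs a network
  -- cover at scale `ε * γ / 2`.
  set K := 2 / γ * T * (Real.sqrt (2 * N) * U ^ (3 / 2 : ℝ)) with hK
  have hU32 : 0 ≤ U ^ (3 / 2 : ℝ) := Real.rpow_nonneg hU _
  have hKsq : K ^ 2 = (2 / γ) ^ 2 * (2 * N * T ^ 2 * U ^ 3) := by
    have h1 : (U ^ (3 / 2 : ℝ)) ^ 2 = U ^ 3 := by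
      rw [← sqrt_pow_three hU, Real.sq_sqrt (by positivity)]
    have h2 : Real.sqrt (2 * N) ^ 2 = 2 * N := Real.sq_sqrt (by positivity)
    rw [hK, mul_pow, mul_pow, mul_pow, h1, h2]
    ring
  have hchain := signAvg_le_chaining hn (v := fun i => lossVec γ y (networkData σ (A i) X))
    (fun i => norm_lossVec_le hγ y _) (K := K) (by positivity) (fun ε hε => by
      obtain ⟨C, hC, hcov⟩ := exists_networkData_cover hL hW hσ hσ0 M ha hs X hTpos
        (by linarith : (∏ i, (ρ i : ℝ)) * dataNorm X ≤ T) (ε := ε * γ / 2) (by positivity)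
      refine ⟨C.image (lossVec γ y), ?_, fun i => ?_⟩
      · have e : 2 * N * T ^ 2 * U ^ 3 / (ε * γ / 2) ^ 2 = K ^ 2 / ε ^ 2 := by
          rw [hKsq]
          field_simp
        rw [← e]
        refine log_le_of_card_le_exp (by positivity) (le_trans ?_ (card_le_exp_of_log_le hC))
        exact_mod_cast Finset.card_image_le
      · obtain ⟨c, hc, hd⟩ := hcov (A i) (hA i)
        refine ⟨_, Finset.mem_image_of_mem _ hc, (norm_lossVec_sub_le hk hγ y _ _).trans ?_⟩
        calc _ ≤ 2 / γ * (ε * γ / 2) := mul_le_mul_of_nonneg_left hd (by positivity)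
          _ = ε := by field_simp) (Nat.log 2 n)
  -- With `⌊log₂ n⌋` levels the chaining remainder is bounded by 2.
  have hpow : (n : ℝ) / 2 ^ Nat.log 2 n ≤ 2 := by
    rw [div_le_iff₀ (by positivity), ← pow_succ']
    exact_mod_cast (Nat.lt_pow_succ_log_self one_lt_two n).le
  have hnum := natLog_mul_sqrt_le hW hn
  calc _ ≤ 2 / n * (2 + 6 * K * Nat.log 2 n) :=
        mul_le_mul_of_nonneg_left (hchain.trans (by linarith)) (by positivity)
    _ = 4 / n + (24 * (Nat.log 2 n : ℝ) * Real.sqrt (2 * N)) *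
          (T * U ^ (3 / 2 : ℝ) / (γ * n)) := by
        rw [hK]
        field_simp
        ring
    _ ≤ 8 / n + (72 * Real.log n * Real.log (2 * width d m)) *
          (T * U ^ (3 / 2 : ℝ) / (γ * n)) := by
        refine add_le_add (div_le_div_of_nonneg_right (by norm_num) hn'.le) ?_
        exact mul_le_mul_of_nonneg_right hnum (by positivity)
    _ = _ := by ring

end Rademacher

/-! ### From finite families to a whole class of weights. -/

section ClassBound

variable {L n : ℕ} {d : Fin (L + 1) → ℕ} {m : Fin L → ℕ}

/-- Joint continuity serves twice: in the weights for the reduction to a dense sequence, in the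
input for measurability. -/
lemma continuous_layerOutput {σ : Nonlinearities d m} (hσ : ∀ i, Continuous (σ i))
    (i : Fin (L + 1)) :
    Continuous fun q : Weights d m × EuclideanSpace ℝ (Fin (d 0)) => layerOutput σ q.1 q.2 i := by
  induction i using Fin.induction with
  | zero => exact continuous_snd
  | succ i ih =>
    simp_rw [layerOutput_succ]
    refine (hσ i).comp ((PiLp.continuous_toLp 2 _).comp (Continuous.matrix_mulVec ?_ ?_))
    · exact (continuous_apply i).comp continuous_fst
    · exact (PiLp.continuous_ofLp 2 _).comp ih

/-- The ramp loss of the network with weights `A` on a labelled point. -/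
noncomputable def netLoss (σ : Nonlinearities d m) (γ : ℝ) (A : Weights d m)
    (z : EuclideanSpace ℝ (Fin (d 0)) × Fin (d (Fin.last L))) : ℝ :=
  ramp γ (-margin (network σ A z.1) z.2)

lemma continuous_ramp_margin {k : ℕ} (hk : 2 ≤ k) {γ : ℝ} (hγ : 0 < γ) (y : Fin k) :
    Continuous fun v : EuclideanSpace ℝ (Fin k) => ramp γ (-margin v y) := by
  refine (LipschitzWith.of_dist_le_mul (K := ⟨2 / γ, by positivity⟩) fun v w => ?_).continuous
  rw [Real.dist_eq, dist_eq_norm]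
  exact abs_ramp_margin_sub_le hk hγ v w y

lemma continuous_netLoss (hk : 2 ≤ d (Fin.last L)) {σ : Nonlinearities d m}
    (hσ : ∀ i, Continuous (σ i)) {γ : ℝ} (hγ : 0 < γ)
    (z : EuclideanSpace ℝ (Fin (d 0)) × Fin (d (Fin.last L))) :
    Continuous fun A => netLoss σ γ A z :=
  (continuous_ramp_margin hk hγ z.2).comp
    ((continuous_layerOutput hσ (Fin.last L)).comp (continuous_id.prodMk continuous_const))

lemma measurable_netLoss (hk : 2 ≤ d (Fin.last L)) {σ : Nonlinearities d m}
    (hσ : ∀ i, Continuous (σ i)) {γ : ℝ} (hγ : 0 < γ) (A : Weights d m) :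
    Measurable (netLoss σ γ A) := by
  refine measurable_from_prod_countable_left fun y => ?_
  exact ((continuous_ramp_margin hk hγ y).comp ((continuous_layerOutput hσ (Fin.last L)).comp
    (continuous_const.prodMk continuous_id))).measurable

/-- The complexity term for weights in a class. -/
noncomputable def classExcess (ρ : Fin L → NNReal) (d : Fin (L + 1) → ℕ) (m : Fin L → ℕ)
    (a s : Fin L → ℝ) (n : ℕ) (γ B : ℝ) : ℝ :=
  8 / n + 72 * Real.log n * Real.log (2 * width d m) / (γ * n) *
    complexitySum a s ^ (3 / 2 : ℝ) * ((∏ i, (ρ i : ℝ)) * B)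

/-- The uniform deviation bound for networks with weights in a class. -/
lemma measure_exists_network_deviation_le (hL : 1 ≤ L) (hk : 2 ≤ d (Fin.last L))
    {σ : Nonlinearities d m} {ρ : Fin L → NNReal} (hσ : ∀ i, LipschitzWith (ρ i) (σ i))
    (hσ0 : ∀ i, σ i 0 = 0) (M : Weights d m) {a s : Fin L → ℝ} (ha : ∀ i, 0 < a i)
    (hs : ∀ i, 0 < s i) {γ : ℝ} (hγ : 0 < γ) (hn : 0 < n)
    (μ : Measure (EuclideanSpace ℝ (Fin (d 0)) × Fin (d (Fin.last L)))) [IsProbabilityMeasure μ]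
    {t : ℝ} (ht : 0 ≤ t) :
    (Measure.pi fun _ : Fin n => μ) {S | ∃ A ∈ weightClass M a s,
        empiricalRampRisk γ (network σ A) S +
          classExcess ρ d m a s n γ (dataNorm fun i => (S i).1) + t < ∫ z, netLoss σ γ A z ∂μ} ≤
      ENNReal.ofReal (Real.exp (-(2 * n * t ^ 2 / 9))) := by
  have hc : ∀ i, Continuous (σ i) := fun i => (hσ i).continuous
  rcases (weightClass M a s).eq_empty_or_nonempty with hempty | hne
  · simp [hempty]
  have : Nonempty (weightClass M a s) := hne.to_subtype
  have hsc : SecondCountableTopology (Weights d m) := by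
    have : ∀ i : Fin L, SecondCountableTopology (Matrix (Fin (m i)) (Fin (d i.castSucc)) ℝ) :=
      fun i => inferInstanceAs (SecondCountableTopology (Fin (m i) → Fin (d i.castSucc) → ℝ))
    infer_instance
  let D : ℕ → weightClass M a s := TopologicalSpace.denseSeq _
  have hD : DenseRange D := TopologicalSpace.denseRange_denseSeq _
  let bad : ℕ → Set (Fin n → EuclideanSpace ℝ (Fin (d 0)) × Fin (d (Fin.last L))) := fun N =>
    {S | ∃ j : Fin (N + 1), empiricalRampRisk γ (network σ (D j)) S +
      classExcess ρ d m a s n γ (dataNorm fun i => (S i).1) + t < ∫ z, netLoss σ γ (D j) z ∂μ}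
  have hbad : ∀ N, (Measure.pi fun _ : Fin n => μ) (bad N) ≤
      ENNReal.ofReal (Real.exp (-(2 * n * t ^ 2 / 9))) := by
    intro N
    refine (measure_mono ?_).trans (measure_exists_deviation_le μ
      (f := fun j : Fin (N + 1) => netLoss σ γ (D j)) (fun j => measurable_netLoss hk hc hγ _)
      (fun j z => ramp_nonneg hγ _) (fun j z => ramp_le_one hγ _) hn ht)
    rintro S ⟨j, hj⟩
    refine ⟨j, lt_of_le_of_lt ?_ hj⟩
    refine add_le_add (add_le_add le_rfl ?_) le_rfl
    exact signAvg_network_le hL hk hσ hσ0 M ha hs (A := fun j : Fin (N + 1) => (D j : Weights d m))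
      (fun j => (D j).2) hγ hn (fun i => (S i).1) fun i => (S i).2
  -- The finite bad events increase and share one probability bound, so their union satisfies it as
  -- well.
  have hmono : Monotone bad := fun N N' h S ⟨j, hj⟩ =>
    ⟨⟨j, by omega⟩, hj⟩
  have hsub : {S | ∃ A ∈ weightClass M a s, empiricalRampRisk γ (network σ A) S +
      classExcess ρ d m a s n γ (dataNorm fun i => (S i).1) + t < ∫ z, netLoss σ γ A z ∂μ} ⊆
      ⋃ N, bad N := by
    rintro S ⟨A, hA, hlt⟩
    have hcE : Continuous fun A : Weights d m => ∫ z, netLoss σ γ A z ∂μ := by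
      refine continuous_of_dominated (bound := fun _ => 1)
        (fun A => (measurable_netLoss hk hc hγ A).aestronglyMeasurable)
        (fun A => Eventually.of_forall fun z => ?_) (integrable_const _)
        (Eventually.of_forall fun z => continuous_netLoss hk hc hγ z)
      rw [Real.norm_eq_abs, netLoss, abs_of_nonneg (ramp_nonneg hγ _)]
      exact ramp_le_one hγ _
    have hcR : Continuous fun A : Weights d m => empiricalRampRisk γ (network σ A) S :=
      continuous_const.mul (continuous_finsetSum _ fun i _ => continuous_netLoss hk hc hγ (S i))
    -- The complexity term is constant on the class, so violating the bound is an open condition on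
    -- `A`; if some `A` violates it, a member of the dense sequence does.
    have hopen : IsOpen {A : weightClass M a s | empiricalRampRisk γ (network σ A) S +
        classExcess ρ d m a s n γ (dataNorm fun i => (S i).1) + t <
          ∫ z, netLoss σ γ (A : Weights d m) z ∂μ} :=
      isOpen_lt (((hcR.comp continuous_subtype_val).add continuous_const).add continuous_const)
        (hcE.comp continuous_subtype_val)
    obtain ⟨N, hN⟩ := hD.exists_mem_open hopen ⟨⟨A, hA⟩, hlt⟩
    exact Set.mem_iUnion.2 ⟨N, ⟨N, by omega⟩, hN⟩
  refine (measure_mono hsub).trans ?_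
  rw [hmono.measure_iUnion]
  exact iSup_le hbad

end ClassBound

/-! ### Weights for the union bound over the parameters. -/

section Grid

/-- Summable weights on the integers. -/
noncomputable def intWeight (j : ℤ) : ℝ := (1 / 2) ^ j.natAbs / 4

/-- Summable weights on the natural numbers. -/
noncomputable def natWeight (p : ℕ) : ℝ := 1 / ((p + 1) * (p + 2))

lemma intWeight_pos (j : ℤ) : 0 < intWeight j := by unfold intWeight; positivity

lemma natWeight_pos (p : ℕ) : 0 < natWeight p := by unfold natWeight; positivity

lemma tsum_intWeight_le : ∑' j : ℤ, ENNReal.ofReal (intWeight j) ≤ 1 := by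
  have h1 : HasSum (fun p : ℕ => intWeight p) (1 / 2) := by
    have := hasSum_geometric_two.div_const 4
    norm_num at this
    simpa [intWeight] using this
  have h2 : HasSum (fun p : ℕ => intWeight (-(p + 1 : ℤ))) (1 / 4) := by
    have := (hasSum_geometric_two.mul_left (1 / 2)).div_const 4
    norm_num at this
    have e : ∀ p : ℕ, intWeight (-(p + 1 : ℤ)) = 1 / 2 * (1 / 2) ^ p / 4 := fun p => by
      have : (-(p + 1 : ℤ)).natAbs = p + 1 := by omega
      rw [intWeight, this, pow_succ']
    simp_rw [e]
    simpa using this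
  have h3 := HasSum.of_nat_of_neg_add_one h1 h2
  rw [← ENNReal.ofReal_tsum_of_nonneg (fun j => (intWeight_pos j).le) h3.summable, h3.tsum_eq]
  norm_num

lemma tsum_natWeight_le : ∑' p : ℕ, ENNReal.ofReal (natWeight p) ≤ 1 := by
  refine ENNReal.tsum_le_of_sum_range_le fun N => ?_
  rw [← ENNReal.ofReal_sum_of_nonneg fun p _ => (natWeight_pos p).le]
  have e : ∀ N : ℕ, ∑ p ∈ Finset.range N, natWeight p = 1 - 1 / (N + 1) := by
    intro N
    induction N with
    | zero => simp
    | succ N ih =>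
      rw [Finset.sum_range_succ, ih, natWeight]
      push_cast
      field_simp
      ring
  rw [e, ← ENNReal.ofReal_one]
  refine ENNReal.ofReal_le_ofReal ?_
  have : (0 : ℝ) ≤ 1 / (N + 1) := by positivity
  linarith

/-- The sum over all tuples is the `L`-th power of the single sum. -/
lemma tsum_prod_le_one {v : ℕ → ENNReal} (hv : ∑' p, v p ≤ 1) (L : ℕ) :
    ∑' f : Fin L → ℕ, ∏ i, v (f i) ≤ 1 := by
  induction L with
  | zero => simp
  | succ L ih =>
    rw [← (Fin.consEquiv fun _ : Fin (L + 1) => ℕ).tsum_eq]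
    simp only [Fin.consEquiv_apply, Fin.prod_univ_succ, Fin.cons_zero, Fin.cons_succ]
    rw [ENNReal.tsum_prod']
    simp_rw [ENNReal.tsum_mul_left, ENNReal.tsum_mul_right]
    exact mul_le_one' hv ih

/-- Weights on the grid of margins, distances and spectral norms. -/
noncomputable def gridWeight {L : ℕ} (g : ℤ × (Fin L → ℕ) × (Fin L → ℕ)) : ℝ :=
  intWeight g.1 * ((∏ i, natWeight (g.2.1 i)) * ∏ i, natWeight (g.2.2 i))

lemma gridWeight_pos {L : ℕ} (g : ℤ × (Fin L → ℕ) × (Fin L → ℕ)) : 0 < gridWeight g :=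
  mul_pos (intWeight_pos _) (mul_pos (Finset.prod_pos fun _ _ => natWeight_pos _)
    (Finset.prod_pos fun _ _ => natWeight_pos _))

lemma tsum_gridWeight_le (L : ℕ) :
    ∑' g : ℤ × (Fin L → ℕ) × (Fin L → ℕ), ENNReal.ofReal (gridWeight g) ≤ 1 := by
  have e : ∀ g : ℤ × (Fin L → ℕ) × (Fin L → ℕ), ENNReal.ofReal (gridWeight g) =
      ENNReal.ofReal (intWeight g.1) * ((∏ i, ENNReal.ofReal (natWeight (g.2.1 i))) *
        ∏ i, ENNReal.ofReal (natWeight (g.2.2 i))) := fun g => by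
    rw [gridWeight, ENNReal.ofReal_mul (intWeight_pos _).le,
      ENNReal.ofReal_mul (Finset.prod_nonneg fun _ _ => (natWeight_pos _).le),
      ENNReal.ofReal_prod_of_nonneg fun _ _ => (natWeight_pos _).le,
      ENNReal.ofReal_prod_of_nonneg fun _ _ => (natWeight_pos _).le]
  simp_rw [e]
  rw [ENNReal.tsum_prod']
  simp_rw [ENNReal.tsum_mul_left, ENNReal.tsum_mul_right]
  refine mul_le_one' tsum_intWeight_le ?_
  rw [ENNReal.tsum_prod']
  simp_rw [ENNReal.tsum_mul_left, ENNReal.tsum_mul_right]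
  exact mul_le_one' (tsum_prod_le_one tsum_natWeight_le L) (tsum_prod_le_one tsum_natWeight_le L)

lemma gridWeight_le_one {L : ℕ} (g : ℤ × (Fin L → ℕ) × (Fin L → ℕ)) : gridWeight g ≤ 1 := by
  have := (ENNReal.le_tsum g).trans (tsum_gridWeight_le L)
  rwa [← ENNReal.ofReal_one, ENNReal.ofReal_le_ofReal_iff zero_le_one] at this

/-- Dyadic rounding down: `|j| log 2` exceeds `|log q|` by at most `log 2`, and the factor `1 / 4`
in `intWeight` adds `2 log 2`. -/
lemma exists_int_grid {q : ℝ} (hq : 0 < q) : ∃ j : ℤ, (2 : ℝ) ^ j ≤ q ∧ q ≤ 2 * 2 ^ j ∧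
    Real.log (1 / intWeight j) ≤ |Real.log q| + 3 * Real.log 2 := by
  obtain ⟨j, hj1, hj2⟩ := exists_mem_Ico_zpow hq one_lt_two
  rw [zpow_add_one₀ two_ne_zero, mul_comm] at hj2
  refine ⟨j, hj1, hj2.le, ?_⟩
  have h2 : (0 : ℝ) < 2 ^ j := by positivity
  have l1 : j * Real.log 2 ≤ Real.log q := by
    rw [← Real.log_zpow]; exact Real.log_le_log h2 hj1
  have l2 : Real.log q ≤ Real.log 2 + j * Real.log 2 := by
    rw [← Real.log_zpow, ← Real.log_mul two_ne_zero h2.ne']; exact Real.log_le_log hq hj2.le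
  have hl2 : 0 < Real.log 2 := Real.log_pos one_lt_two
  have e : Real.log (1 / intWeight j) = j.natAbs * Real.log 2 + 2 * Real.log 2 := by
    have : 1 / intWeight j = 2 ^ j.natAbs * 2 ^ 2 := by
      rw [intWeight, one_div_pow]
      field_simp
      norm_num
    rw [this, Real.log_mul (by positivity) (by positivity), Real.log_pow, Real.log_pow]
    norm_num
  rw [e]
  have habs : ((j.natAbs : ℕ) : ℝ) = |(j : ℝ)| := by
    rw [Nat.cast_natAbs, Int.cast_abs]
  rw [habs]
  rcases abs_cases (j : ℝ) with ⟨h, _⟩ | ⟨h, _⟩ <;> rw [h] <;>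
    nlinarith [le_abs_self (Real.log q), neg_abs_le (Real.log q)]

/-- With `p = ⌊L * r⌋₊` the overshoot is at most `1 / L`, and `(p + 1) * (p + 2) ≤ (2 + L * r) ^ 2`.
-/
lemma exists_nat_grid {L : ℕ} (hL : 1 ≤ L) {r : ℝ} (hr : 0 ≤ r) : ∃ p : ℕ,
    r ≤ ((p : ℝ) + 1) / L ∧ ((p : ℝ) + 1) / L ≤ 1 / L + r ∧
      Real.log (1 / natWeight p) ≤ 2 * Real.log (2 + L * r) := by
  have hL' : (0 : ℝ) < L := by exact_mod_cast hL
  have h1 : (⌊L * r⌋₊ : ℝ) ≤ L * r := Nat.floor_le (by positivity)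
  have h2 : L * r < (⌊L * r⌋₊ : ℝ) + 1 := Nat.lt_floor_add_one _
  refine ⟨⌊L * r⌋₊, ?_, ?_, ?_⟩
  · rw [le_div_iff₀ hL']; linarith
  · rw [div_le_iff₀ hL', add_mul, one_div, inv_mul_cancel₀ hL'.ne']; linarith
  · rw [natWeight, one_div_one_div, ← Nat.cast_ofNat (R := ℝ) (n := 2), ← Real.log_pow]
    refine Real.log_le_log (by positivity) ?_
    push_cast
    nlinarith

end Grid

/-! ### The generalization bound, uniform in all parameters. -/

section Generalization

variable {L n : ℕ} {d : Fin (L + 1) → ℕ} {m : Fin L → ℕ}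

lemma norm21_nonneg {p q : ℕ} (A : Matrix (Fin p) (Fin q) ℝ) : 0 ≤ norm21 A :=
  Finset.sum_nonneg fun _ _ => Real.sqrt_nonneg _

lemma complexitySum_mono {a s a' s' : Fin L → ℝ} (ha : ∀ i, 0 ≤ a i) (hs : ∀ i, 0 ≤ s i)
    (haa : ∀ i, a i ≤ a' i) (hss : ∀ i, s i ≤ s' i) :
    complexitySum a s ≤ complexitySum a' s' := by
  refine Finset.sum_le_sum fun i _ => Real.rpow_le_rpow
    (mul_nonneg (ha i) (Finset.prod_nonneg fun j _ => hs j)) ?_ (by norm_num)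
  exact mul_le_mul (haa i) (Finset.prod_le_prod (fun j _ => hs j) fun j _ => hss j)
    (Finset.prod_nonneg fun j _ => hs j) ((ha i).trans (haa i))

lemma classExcess_add_le_excess (hW : 1 ≤ width d m) (ρ : Fin L → NNReal) (M A : Weights d m)
    {δ : ℝ} (hn : 0 < n) {γ γ' B ℓ : ℝ} (hγ' : 0 < γ') (hγ : γ' ≤ γ) (hγ2 : γ ≤ 2 * γ') (hB : 0 ≤ B)
    {a s : Fin L → ℝ} (ha : ∀ i, 0 ≤ a i) (hs : ∀ i, 0 ≤ s i)
    (haA : ∀ i, a i ≤ 1 / L + norm21 ((A i).transpose - (M i).transpose))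
    (hsA : ∀ i, s i ≤ 1 / L + spectralNorm (A i))
    (hℓ : ℓ ≤ Real.log (1 / δ) + (Real.log 2 + |Real.log (n / γ)|) + 2 * Real.log (2 + B) +
      2 * ∑ i, Real.log (2 + L * norm21 ((A i).transpose - (M i).transpose)) +
      2 * ∑ i, Real.log (2 + L * spectralNorm (A i))) :
    classExcess ρ d m a s n γ' B + Real.sqrt (9 / (2 * n)) * Real.sqrt ℓ ≤
      excess ρ M δ n γ B A := by
  have hn' : (0 : ℝ) < n := by exact_mod_cast hn
  have hW' : (1 : ℝ) ≤ width d m := by exact_mod_cast hW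
  have hγ0 : 0 < γ := hγ'.trans_le hγ
  have hlogn : 0 ≤ Real.log n := Real.log_natCast_nonneg n
  have hlogW : 0 ≤ Real.log (2 * width d m) := Real.log_nonneg (by linarith)
  have hρ : 0 ≤ ∏ i, (ρ i : ℝ) := Finset.prod_nonneg fun i _ => (ρ i).2
  unfold classExcess excess
  refine add_le_add (add_le_add le_rfl ?_)
    (mul_le_mul_of_nonneg_left (Real.sqrt_le_sqrt hℓ) (Real.sqrt_nonneg _))
  set U' := complexitySum (fun i => 1 / (L : ℝ) + norm21 ((A i).transpose - (M i).transpose))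
    fun i => 1 / (L : ℝ) + spectralNorm (A i) with hU'
  have hU0 : 0 ≤ complexitySum a s := complexitySum_nonneg ha hs
  have hUU : complexitySum a s ^ (3 / 2 : ℝ) ≤ U' ^ (3 / 2 : ℝ) :=
    Real.rpow_le_rpow hU0 (complexitySum_mono ha hs haA hsA) (by norm_num)
  have hcoef : 72 * Real.log n * Real.log (2 * width d m) / (γ' * n) ≤
      144 * Real.log n * Real.log (2 * width d m) / (γ * n) := by
    rw [div_le_div_iff₀ (by positivity) (by positivity)]
    have : 0 ≤ Real.log n * Real.log (2 * width d m) * n := by positivity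
    nlinarith
  calc _ ≤ 144 * Real.log n * Real.log (2 * width d m) / (γ * n) * U' ^ (3 / 2 : ℝ) *
        ((∏ i, (ρ i : ℝ)) * (1 + B)) := by
        refine mul_le_mul (mul_le_mul hcoef hUU (Real.rpow_nonneg hU0 _) (by positivity))
          (mul_le_mul_of_nonneg_left (by linarith) hρ) (by positivity) ?_
        have : 0 ≤ U' ^ (3 / 2 : ℝ) := (Real.rpow_nonneg hU0 _).trans hUU
        positivity
    _ = 144 * Real.log n * Real.log (2 * width d m) / (γ * n) * (∏ i, (ρ i : ℝ)) * (1 + B) *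
        U' ^ (3 / 2 : ℝ) := by ring
    _ = _ := rfl

/-- A misclassified point has nonpositive margin, hence ramp loss 1, and Markov's inequality
applies. The error set may be nonmeasurable, as `c` is arbitrary; only monotonicity of the outer
measure is used for it. -/
lemma measureReal_ne_le_integral_netLoss (hk : 2 ≤ d (Fin.last L)) {σ : Nonlinearities d m}
    (hσ : ∀ i, Continuous (σ i)) {γ : ℝ} (hγ : 0 < γ)
    (μ : Measure (EuclideanSpace ℝ (Fin (d 0)) × Fin (d (Fin.last L)))) [IsProbabilityMeasure μ]
    (A : Weights d m) {c : EuclideanSpace ℝ (Fin (d 0)) → Fin (d (Fin.last L))}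
    (hc : ∀ x j, network σ A x j ≤ network σ A x (c x)) :
    μ.real {z | c z.1 ≠ z.2} ≤ ∫ z, netLoss σ γ A z ∂μ := by
  have hsub : {z : EuclideanSpace ℝ (Fin (d 0)) × Fin (d (Fin.last L)) | c z.1 ≠ z.2} ⊆
      {z | 1 ≤ netLoss σ γ A z} := by
    intro z hz
    have hle : network σ A z.1 (c z.1) ≤
        ⨆ j : {j : Fin (d (Fin.last L)) // j ≠ z.2}, network σ A z.1 j :=
      le_ciSup (f := fun j : {j : Fin (d (Fin.last L)) // j ≠ z.2} => network σ A z.1 j)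
        (Set.finite_range _).bddAbove ⟨c z.1, hz⟩
    refine (ramp_eq_one hγ ?_).ge
    have := hc z.1 z.2
    unfold margin
    linarith
  have hint : Integrable (netLoss σ γ A) μ :=
    integrable_of_measurable_of_abs_le (measurable_netLoss hk hσ hγ A) (B := 1) fun z => by
      rw [netLoss, abs_of_nonneg (ramp_nonneg hγ _)]
      exact ramp_le_one hγ _
  have hmark := mul_meas_ge_le_integral_of_nonneg (μ := μ)
    (Eventually.of_forall fun z => ramp_nonneg hγ _ : 0 ≤ᵐ[μ] netLoss σ γ A) hint 1
  rw [one_mul] at hmark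
  exact (measureReal_mono hsub).trans hmark

/-- The generalization bound. -/
lemma generalization_bound (hL : 1 ≤ L) (hk : 2 ≤ d (Fin.last L))
    {σ : Nonlinearities d m} {ρ : Fin L → NNReal} (hσ : ∀ i, LipschitzWith (ρ i) (σ i))
    (hσ0 : ∀ i, σ i 0 = 0) (M : Weights d m) {δ : ℝ} (hδ : 0 < δ) (hδ1 : δ < 1)
    (μ : Measure (EuclideanSpace ℝ (Fin (d 0)) × Fin (d (Fin.last L)))) [IsProbabilityMeasure μ]
    (hn : 1 ≤ n) :
    (Measure.pi fun _ : Fin n => μ)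
      {S | ¬ ∀ (γ : ℝ) (_ : 0 < γ) (A : Weights d m)
          (c : EuclideanSpace ℝ (Fin (d 0)) → Fin (d (Fin.last L)))
          (_ : ∀ x j, network σ A x j ≤ network σ A x (c x)),
          μ.real {z | c z.1 ≠ z.2} ≤ empiricalRampRisk γ (network σ A) S +
            excess ρ M δ n γ (dataNorm fun i => (S i).1) A} ≤ ENNReal.ofReal δ := by
  have hn' : (0 : ℝ) < n := by exact_mod_cast hn
  have hL' : (0 : ℝ) < L := by exact_mod_cast hL
  have hW : 1 ≤ width d m := le_trans (by omega) (hk.trans (layer_le_width_left _))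
  let Γ : ℤ × (Fin L → ℕ) × (Fin L → ℕ) → ℝ := fun g => n * 2 ^ g.1
  let a : ℤ × (Fin L → ℕ) × (Fin L → ℕ) → Fin L → ℝ := fun g i => ((g.2.1 i : ℝ) + 1) / L
  let s : ℤ × (Fin L → ℕ) × (Fin L → ℕ) → Fin L → ℝ := fun g i => ((g.2.2 i : ℝ) + 1) / L
  -- Chosen so that deviation `√(9 / (2 n)) * √(ℓ g)` fails in cell `g` with probability at most `δ
  -- * gridWeight g`.
  let ℓ : ℤ × (Fin L → ℕ) × (Fin L → ℕ) → ℝ := fun g => Real.log (1 / (δ * gridWeight g))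
  have hΓ : ∀ g, 0 < Γ g := fun g => by positivity
  have ha : ∀ g i, 0 < a g i := fun g i => by positivity
  have hs : ∀ g i, 0 < s g i := fun g i => by positivity
  have hℓ : ∀ g, 0 ≤ ℓ g := fun g => Real.log_nonneg (by
    have := gridWeight_pos g
    rw [le_div_iff₀ (by positivity), one_mul]
    exact mul_le_one₀ hδ1.le this.le (gridWeight_le_one g))
  let bad : ℤ × (Fin L → ℕ) × (Fin L → ℕ) →
      Set (Fin n → EuclideanSpace ℝ (Fin (d 0)) × Fin (d (Fin.last L))) := fun g =>
    {S | ∃ A ∈ weightClass M (a g) (s g), empiricalRampRisk (Γ g) (network σ A) S +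
      classExcess ρ d m (a g) (s g) n (Γ g) (dataNorm fun i => (S i).1) +
        Real.sqrt (9 / (2 * n)) * Real.sqrt (ℓ g) < ∫ z, netLoss σ (Γ g) A z ∂μ}
  have hbad : ∀ g, (Measure.pi fun _ : Fin n => μ) (bad g) ≤
      ENNReal.ofReal δ * ENNReal.ofReal (gridWeight g) := by
    intro g
    have hw := gridWeight_pos g
    refine (measure_exists_network_deviation_le hL hk hσ hσ0 M (ha g) (hs g) (hΓ g) hn μ
      (t := Real.sqrt (9 / (2 * n)) * Real.sqrt (ℓ g)) (by positivity)).trans (le_of_eq ?_)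
    rw [← ENNReal.ofReal_mul hδ.le]
    congr 1
    have e : 2 * n * (Real.sqrt (9 / (2 * n)) * Real.sqrt (ℓ g)) ^ 2 / 9 = ℓ g := by
      rw [mul_pow, Real.sq_sqrt (by positivity), Real.sq_sqrt (hℓ g)]
      field_simp
    rw [e]
    simp only [ℓ]
    rw [one_div, Real.log_inv, neg_neg, Real.exp_log (by positivity)]
  have hsub : {S | ¬ ∀ (γ : ℝ) (_ : 0 < γ) (A : Weights d m)
          (c : EuclideanSpace ℝ (Fin (d 0)) → Fin (d (Fin.last L)))
          (_ : ∀ x j, network σ A x j ≤ network σ A x (c x)),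
          μ.real {z | c z.1 ≠ z.2} ≤ empiricalRampRisk γ (network σ A) S +
            excess ρ M δ n γ (dataNorm fun i => (S i).1) A} ⊆ ⋃ g, bad g := by
    intro S hS
    simp only [Set.mem_ofPred_eq, not_forall, not_le] at hS
    obtain ⟨γ, hγ, A, c, hc, hlt⟩ := hS
    obtain ⟨j, hj1, hj2, hj3⟩ := exists_int_grid (q := γ / n) (by positivity)
    choose p hp1 hp2 hp3 using fun i =>
      exists_nat_grid hL (norm21_nonneg ((A i).transpose - (M i).transpose))
    choose q hq1 hq2 hq3 using fun i => exists_nat_grid hL (spectralNorm_nonneg (A i))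
    refine Set.mem_iUnion.2 ⟨(j, p, q), A, fun i => ⟨hq1 i, hp1 i⟩, ?_⟩
    set g : ℤ × (Fin L → ℕ) × (Fin L → ℕ) := (j, p, q)
    have hB : 0 ≤ dataNorm fun i => (S i).1 := Real.sqrt_nonneg _
    have hΓγ : Γ g ≤ γ := by
      have := (le_div_iff₀ hn').1 hj1
      simp only [Γ, g]
      linarith
    have hγΓ : γ ≤ 2 * Γ g := by
      have := (div_le_iff₀ hn').1 hj2
      simp only [Γ, g]
      linarith
    -- Of the three `log 2` paid for the margin grid one stays explicit and two are absorbed by `2 *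
    -- Real.log (2 + dataNorm _)`. No grid over data norms is needed.
    have hlog : ℓ g ≤ Real.log (1 / δ) + (Real.log 2 + |Real.log (n / γ)|) +
        2 * Real.log (2 + dataNorm fun i => (S i).1) +
        2 * ∑ i, Real.log (2 + L * norm21 ((A i).transpose - (M i).transpose)) +
        2 * ∑ i, Real.log (2 + L * spectralNorm (A i)) := by
      have e1 : ∀ r : Fin L → ℕ, Real.log (∏ i, natWeight (r i)) =
          -∑ i, Real.log (1 / natWeight (r i)) := fun r => by
        rw [Real.log_prod fun i _ => (natWeight_pos _).ne', ← Finset.sum_neg_distrib]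
        simp
      have hprod : ∀ r : Fin L → ℕ, ∏ i, natWeight (r i) ≠ 0 := fun r =>
        (Finset.prod_pos fun _ _ => natWeight_pos _).ne'
      have e2 : ℓ g = Real.log (1 / δ) + Real.log (1 / intWeight j) +
          ∑ i, Real.log (1 / natWeight (p i)) + ∑ i, Real.log (1 / natWeight (q i)) := by
        simp only [ℓ, g, gridWeight]
        rw [one_div, Real.log_inv, Real.log_mul hδ.ne'
          (mul_ne_zero (intWeight_pos j).ne' (mul_ne_zero (hprod p) (hprod q))),
          Real.log_mul (intWeight_pos j).ne' (mul_ne_zero (hprod p) (hprod q)),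
          Real.log_mul (hprod p) (hprod q), e1, e1, one_div, Real.log_inv, one_div, Real.log_inv]
        ring
      have h1 : ∑ i, Real.log (1 / natWeight (p i)) ≤
          2 * ∑ i, Real.log (2 + L * norm21 ((A i).transpose - (M i).transpose)) := by
        rw [Finset.mul_sum]
        exact Finset.sum_le_sum fun i _ => hp3 i
      have h2 : ∑ i, Real.log (1 / natWeight (q i)) ≤
          2 * ∑ i, Real.log (2 + L * spectralNorm (A i)) := by
        rw [Finset.mul_sum]
        exact Finset.sum_le_sum fun i _ => hq3 i
      have h3 : Real.log 2 ≤ Real.log (2 + dataNorm fun i => (S i).1) :=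
        Real.log_le_log two_pos (by linarith)
      have h4 : |Real.log (γ / n)| = |Real.log (n / γ)| := by
        rw [← inv_div, Real.log_inv, abs_neg]
      rw [h4] at hj3
      rw [e2]
      linarith
    have hex := classExcess_add_le_excess hW ρ M A hn (hΓ g) hΓγ hγΓ hB
      (fun i => (ha g i).le) (fun i => (hs g i).le) hp2 hq2 hlog
    have hemp : empiricalRampRisk (Γ g) (network σ A) S ≤ empiricalRampRisk γ (network σ A) S :=
      mul_le_mul_of_nonneg_left
        (Finset.sum_le_sum fun i _ => ramp_mono_left (hΓ g) hΓγ _) (by positivity)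
    have herr := measureReal_ne_le_integral_netLoss hk (fun i => (hσ i).continuous) (hΓ g) μ A hc
    change _ < _
    linarith
  calc _ ≤ (Measure.pi fun _ : Fin n => μ) (⋃ g, bad g) := measure_mono hsub
    _ ≤ ∑' g, (Measure.pi fun _ : Fin n => μ) (bad g) := measure_iUnion_le _
    _ ≤ ∑' g : ℤ × (Fin L → ℕ) × (Fin L → ℕ), ENNReal.ofReal δ * ENNReal.ofReal (gridWeight g) :=
        ENNReal.tsum_le_tsum hbad
    _ = ENNReal.ofReal δ * ∑' g : ℤ × (Fin L → ℕ) × (Fin L → ℕ), ENNReal.ofReal (gridWeight g) :=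
        ENNReal.tsum_mul_left
    _ ≤ ENNReal.ofReal δ * 1 := by gcongr; exact tsum_gridWeight_le L
    _ = ENNReal.ofReal δ := mul_one _

end Generalization

/-! ### Comparison of ramp risk and margin error. -/

section MarginError

lemma empiricalRampRisk_le_empiricalMarginError {n q k : ℕ} {γ : ℝ} (hγ : 0 < γ)
    (f : EuclideanSpace ℝ (Fin q) → EuclideanSpace ℝ (Fin k))
    (S : Fin n → EuclideanSpace ℝ (Fin q) × Fin k) :
    empiricalRampRisk γ f S ≤ empiricalMarginError γ f S := by
  refine mul_le_mul_of_nonneg_left (Finset.sum_le_sum fun i _ => ?_) (by positivity)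
  split_ifs with h
  · exact ramp_le_one hγ _
  · rw [ramp, if_pos]
    unfold margin
    linarith

end MarginError

/-! ### Asymptotic comparison of the excess with the rate. -/

section Rate

variable {L : ℕ} {d : Fin (L + 1) → ℕ} {m : Fin L → ℕ}

lemma norm_mulData_le_norm21 {n p q : ℕ} (A : Matrix (Fin p) (Fin q) ℝ) (Z : DataSpace n q) :
    ‖mulData A Z‖ ≤ norm21 A.transpose * ‖Z‖ := by
  rw [mulData_eq_sum]
  exact (norm_sum_smul_le (norm_columnAtom_le Z) _).trans (sum_abs_mul_coordNorm_le A Z)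

/-- The atomic decomposition used for covering, applied to a single data point. -/
lemma spectralNorm_le_norm21 {p q : ℕ} (A : Matrix (Fin p) (Fin q) ℝ) :
    spectralNorm A ≤ norm21 A.transpose := by
  have hdef : spectralNorm A = ‖Matrix.toEuclideanLin A |>.toContinuousLinearMap‖ := by
    open scoped Matrix.Norms.L2Operator in
    exact Matrix.l2_opNorm_def A
  rw [hdef]
  refine ContinuousLinearMap.opNorm_le_bound _ (norm21_nonneg _) fun z => ?_
  have h := norm_mulData_le_norm21 A (WithLp.toLp 2 fun _ => z : DataSpace 1 q)
  have e : ∀ {r : ℕ} (w : EuclideanSpace ℝ (Fin r)),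
      ‖(WithLp.toLp 2 fun _ => w : DataSpace 1 r)‖ = ‖w‖ := fun w => by
    rw [← Real.sqrt_sq (norm_nonneg (WithLp.toLp 2 fun _ => w : DataSpace 1 _)),
      dataSpace_norm_sq]
    simp
  rw [e] at h
  have h2 := e (WithLp.toLp 2 (A.mulVec z) : EuclideanSpace ℝ (Fin p))
  calc _ = ‖mulData A (WithLp.toLp 2 fun _ => z : DataSpace 1 q)‖ := h2.symm
    _ ≤ _ := h

lemma spectralNorm_sub_le {p q : ℕ} (A M : Matrix (Fin p) (Fin q) ℝ) :
    spectralNorm A ≤ norm21 (A.transpose - M.transpose) + spectralNorm M := by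
  have h1 : spectralNorm A ≤ spectralNorm (A - M) + spectralNorm M := by
    open scoped Matrix.Norms.L2Operator in
    exact norm_le_norm_sub_add A M
  have h2 := spectralNorm_le_norm21 (A - M)
  rw [Matrix.transpose_sub] at h2
  linarith

lemma spectralComplexity_eq (ρ : Fin L → NNReal) (M A : Weights d m) :
    spectralComplexity ρ M A = (∏ i, (ρ i : ℝ)) * ((∏ i, spectralNorm (A i)) *
      (∑ i, norm21 ((A i).transpose - (M i).transpose) ^ (2 / 3 : ℝ) /
        spectralNorm (A i) ^ (2 / 3 : ℝ)) ^ (3 / 2 : ℝ)) := by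
  rw [spectralComplexity, Finset.prod_mul_distrib, mul_assoc]

lemma rpow_two_thirds_rpow {x : ℝ} (hx : 0 ≤ x) : (x ^ (2 / 3 : ℝ)) ^ (3 / 2 : ℝ) = x := by
  rw [← Real.rpow_mul hx]
  norm_num

/-- For `x ≥ 1` the shift costs a factor `1 + 1 / L`. Each summand contains `L` shifted factors, and
`(1 + 1 / L) ^ L ≤ e ≤ 3`. -/
lemma complexitySum_shift_le (hL : 1 ≤ L) {a s : Fin L → ℝ} (ha : ∀ i, 1 ≤ a i)
    (hs : ∀ i, 1 ≤ s i) :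
    complexitySum (fun i => 1 / (L : ℝ) + a i) (fun i => 1 / (L : ℝ) + s i) ^ (3 / 2 : ℝ) ≤
      3 * ((∏ i, s i) * (∑ i, a i ^ (2 / 3 : ℝ) / s i ^ (2 / 3 : ℝ)) ^ (3 / 2 : ℝ)) := by
  have hL' : (0 : ℝ) < L := by exact_mod_cast hL
  have hs0 : ∀ i, 0 < s i := fun i => zero_lt_one.trans_le (hs i)
  have ha0 : ∀ i, 0 < a i := fun i => zero_lt_one.trans_le (ha i)
  have hP : 0 < ∏ i, s i := Finset.prod_pos fun i _ => hs0 i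
  have hq0 : (0 : ℝ) < 1 + 1 / L := by positivity
  have hq : (1 + 1 / (L : ℝ)) ^ L ≤ 3 := by
    have h1 : 1 + 1 / (L : ℝ) ≤ Real.exp (1 / L) := by
      have := Real.add_one_le_exp (1 / (L : ℝ)); linarith
    calc _ ≤ Real.exp (1 / L) ^ L := pow_le_pow_left₀ hq0.le h1 L
      _ = Real.exp 1 := by rw [← Real.exp_nat_mul]; congr 1; field_simp
      _ ≤ 3 := by linarith [Real.exp_one_lt_d9]
  have hshift : ∀ x : ℝ, 1 ≤ x → 1 / (L : ℝ) + x ≤ (1 + 1 / L) * x := fun x hx => by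
    have : 1 / (L : ℝ) ≤ 1 / L * x := le_mul_of_one_le_right (by positivity) hx
    linarith
  have hterm : ∀ i, (1 / (L : ℝ) + a i) * ∏ j ∈ Finset.univ.erase i, (1 / (L : ℝ) + s j) ≤
      (3 * ∏ j, s j) * (a i / s i) := by
    intro i
    have hPe : 0 < ∏ j ∈ Finset.univ.erase i, s j := Finset.prod_pos fun j _ => hs0 j
    have hprod := Finset.mul_prod_erase Finset.univ s (Finset.mem_univ i)
    have h1 : ∏ j ∈ Finset.univ.erase i, (1 / (L : ℝ) + s j) ≤
        (1 + 1 / L) ^ (L - 1) * ∏ j ∈ Finset.univ.erase i, s j := by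
      calc _ ≤ ∏ j ∈ Finset.univ.erase i, (1 + 1 / (L : ℝ)) * s j :=
            Finset.prod_le_prod (fun j _ => by have := hs0 j; positivity) fun j _ =>
              hshift _ (hs j)
        _ = _ := by
            rw [Finset.prod_mul_distrib, Finset.prod_const,
              Finset.card_erase_of_mem (Finset.mem_univ i)]
            simp
    calc _ ≤ ((1 + 1 / (L : ℝ)) * a i) *
          ((1 + 1 / L) ^ (L - 1) * ∏ j ∈ Finset.univ.erase i, s j) := by
          refine mul_le_mul (hshift _ (ha i)) h1 ?_ (by have := ha0 i; positivity)
          exact Finset.prod_nonneg fun j _ => by have := hs0 j; positivity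
      _ = (1 + 1 / (L : ℝ)) ^ L * (a i * ∏ j ∈ Finset.univ.erase i, s j) := by
          rw [← mul_pow_sub_one (by omega : L ≠ 0) (1 + 1 / (L : ℝ))]
          ring
      _ ≤ 3 * (a i * ∏ j ∈ Finset.univ.erase i, s j) :=
          mul_le_mul_of_nonneg_right hq (by have := ha0 i; positivity)
      _ = _ := by
          rw [← hprod]
          have := (hs0 i).ne'
          field_simp
  have hsum : complexitySum (fun i => 1 / (L : ℝ) + a i) (fun i => 1 / (L : ℝ) + s i) ≤
      (3 * ∏ j, s j) ^ (2 / 3 : ℝ) * ∑ i, a i ^ (2 / 3 : ℝ) / s i ^ (2 / 3 : ℝ) := by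
    rw [complexitySum, Finset.mul_sum]
    refine Finset.sum_le_sum fun i _ => ?_
    rw [← Real.div_rpow (ha0 i).le (hs0 i).le,
      ← Real.mul_rpow (by positivity) (div_nonneg (ha0 i).le (hs0 i).le)]
    refine Real.rpow_le_rpow ?_ (hterm i) (by norm_num)
    exact mul_nonneg (by have := ha0 i; positivity)
      (Finset.prod_nonneg fun j _ => by have := hs0 j; positivity)
  have hS : 0 ≤ ∑ i, a i ^ (2 / 3 : ℝ) / s i ^ (2 / 3 : ℝ) := Finset.sum_nonneg fun i _ =>
    div_nonneg (Real.rpow_nonneg (ha0 i).le _) (Real.rpow_nonneg (hs0 i).le _)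
  calc _ ≤ ((3 * ∏ j, s j) ^ (2 / 3 : ℝ) *
        ∑ i, a i ^ (2 / 3 : ℝ) / s i ^ (2 / 3 : ℝ)) ^ (3 / 2 : ℝ) := by
        refine Real.rpow_le_rpow (complexitySum_nonneg (fun i => ?_) fun i => ?_) hsum
          (by norm_num)
        · have := ha0 i; positivity
        · have := hs0 i; positivity
    _ = _ := by
        rw [Real.mul_rpow (by positivity) hS, rpow_two_thirds_rpow (by positivity), mul_assoc]

/-- Keep one summand, giving the ratio of distance to norm, and drop the other factors `ρ j * s j ≥
1`. Thus the complexity dominates every distance, and its logarithm theirs. -/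
lemma mul_norm21_le_spectralComplexity {ρ : Fin L → NNReal} {M A : Weights d m}
    (h : ∀ i, 1 ≤ (ρ i : ℝ) * spectralNorm (A i)) (i : Fin L) :
    ρ i * norm21 ((A i).transpose - (M i).transpose) ≤ spectralComplexity ρ M A := by
  have hs : ∀ i, 0 < spectralNorm (A i) := fun i =>
    lt_of_le_of_ne (spectralNorm_nonneg _) fun h0 => by
      have := h i
      rw [← h0] at this
      norm_num at this
  have ha := norm21_nonneg ((A i).transpose - (M i).transpose)
  have h1 : norm21 ((A i).transpose - (M i).transpose) / spectralNorm (A i) ≤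
      (∑ i, norm21 ((A i).transpose - (M i).transpose) ^ (2 / 3 : ℝ) /
        spectralNorm (A i) ^ (2 / 3 : ℝ)) ^ (3 / 2 : ℝ) := by
    rw [← rpow_two_thirds_rpow (div_nonneg ha (hs i).le), Real.div_rpow ha (hs i).le]
    refine Real.rpow_le_rpow (div_nonneg (Real.rpow_nonneg ha _) (Real.rpow_nonneg (hs i).le _))
      ?_ (by norm_num)
    exact Finset.single_le_sum (f := fun i =>
      norm21 ((A i).transpose - (M i).transpose) ^ (2 / 3 : ℝ) / spectralNorm (A i) ^ (2 / 3 : ℝ))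
      (fun j _ => div_nonneg (Real.rpow_nonneg (norm21_nonneg _) _)
        (Real.rpow_nonneg (hs j).le _)) (Finset.mem_univ i)
  have h2 : (ρ i : ℝ) * spectralNorm (A i) ≤ ∏ j, (ρ j : ℝ) * spectralNorm (A j) := by
    rw [← Finset.mul_prod_erase Finset.univ (fun j => (ρ j : ℝ) * spectralNorm (A j))
      (Finset.mem_univ i)]
    exact le_mul_of_one_le_right (zero_le_one.trans (h i)) (Finset.one_le_prod fun j _ => h j)
  have := hs i
  calc _ = ((ρ i : ℝ) * spectralNorm (A i)) *
        (norm21 ((A i).transpose - (M i).transpose) / spectralNorm (A i)) := by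
        field_simp
    _ ≤ _ := mul_le_mul h2 h1 (div_nonneg ha (hs i).le)
        ((zero_le_one.trans (h i)).trans h2)

/-- The part of the bound for the logarithmic terms that depends on fixed data only. -/
noncomputable def logConstant (ρ : Fin L → NNReal) (δ : ℝ) : ℝ :=
  Real.log (1 / δ) + 7 + ∑ i, (4 * Real.log (2 + L) - 4 * Real.log (ρ i) + 2)

lemma log_two_add_mul_le {c x : ℝ} (hc : 0 ≤ c) (hx : 1 ≤ x) :
    Real.log (2 + c * x) ≤ Real.log (2 + c) + Real.log x := by
  rw [← Real.log_mul (by positivity) (by positivity)]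
  exact Real.log_le_log (by positivity) (by nlinarith)

/-- The bound for the sum of logarithms in the excess. -/
lemma log_terms_le {ρ : Fin L → NNReal} (hρ : ∀ i, 0 < ρ i) {M A : Weights d m}
    (hL : 1 ≤ L) {δ : ℝ} {n : ℕ} {γ B : ℝ} (hn : 1 ≤ n) (hγ : 0 < γ) (hB : 1 ≤ B)
    (ha : ∀ i, 1 ≤ norm21 ((A i).transpose - (M i).transpose))
    (hs : ∀ i, 1 ≤ spectralNorm (A i))
    (hsa : ∀ i, spectralNorm (A i) ≤ 2 * norm21 ((A i).transpose - (M i).transpose))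
    (hρs : ∀ i, 2 ≤ (ρ i : ℝ) * spectralNorm (A i)) :
    Real.log (1 / δ) + (Real.log 2 + |Real.log (n / γ)|) + 2 * Real.log (2 + B) +
      2 * ∑ i, Real.log (2 + L * norm21 ((A i).transpose - (M i).transpose)) +
      2 * ∑ i, Real.log (2 + L * spectralNorm (A i)) ≤
        logConstant ρ δ + (2 + 4 * L) * logFactor ρ M n γ B A ∧
      1 ≤ spectralComplexity ρ M A := by
  have hn' : (1 : ℝ) ≤ n := by exact_mod_cast hn
  have hR : ∀ i, ρ i * norm21 ((A i).transpose - (M i).transpose) ≤ spectralComplexity ρ M A :=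
    mul_norm21_le_spectralComplexity fun i => by linarith [hρs i]
  have hR1 : 1 ≤ spectralComplexity ρ M A := by
    have h1 := hR ⟨0, hL⟩
    have h2 := hρs ⟨0, hL⟩
    have h3 := mul_le_mul_of_nonneg_left (hsa ⟨0, hL⟩) (ρ ⟨0, hL⟩).2
    change (ρ _ : ℝ) * _ ≤ (ρ _ : ℝ) * _ at h3
    linarith
  refine ⟨?_, hR1⟩
  set R := spectralComplexity ρ M A
  have hl2 : Real.log 2 ≤ 1 := by linarith [Real.log_two_lt_d9]
  have hlogn : 0 ≤ Real.log n := Real.log_nonneg hn'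
  have hlogB : 0 ≤ Real.log B := Real.log_nonneg hB
  have hlogR : 0 ≤ Real.log R := Real.log_nonneg hR1
  have h1 : |Real.log (n / γ)| ≤ Real.log n + |Real.log γ| := by
    rw [Real.log_div (by positivity) hγ.ne']
    refine (abs_sub _ _).trans ?_
    rw [abs_of_nonneg hlogn]
  have h2 : Real.log (2 + B) ≤ 2 + Real.log B := by
    have := log_two_add_mul_le zero_le_one hB
    rw [one_mul] at this
    have h3 : Real.log (2 + 1) ≤ 2 := by
      have := Real.log_le_sub_one_of_pos (by norm_num : (0 : ℝ) < 2 + 1)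
      linarith
    linarith
  have hloga : ∀ i, Real.log (norm21 ((A i).transpose - (M i).transpose)) ≤
      Real.log R - Real.log (ρ i) := fun i => by
    have hρi : (0 : ℝ) < ρ i := hρ i
    have hai : 0 < norm21 ((A i).transpose - (M i).transpose) := by linarith [ha i]
    have := Real.log_le_log (by positivity) (hR i)
    rw [Real.log_mul hρi.ne' hai.ne'] at this
    linarith
  have h3 : ∀ i, Real.log (2 + L * norm21 ((A i).transpose - (M i).transpose)) ≤
      Real.log (2 + L) + (Real.log R - Real.log (ρ i)) := fun i =>
    (log_two_add_mul_le (Nat.cast_nonneg L) (ha i)).trans (by linarith [hloga i])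
  have h4 : ∀ i, Real.log (2 + L * spectralNorm (A i)) ≤
      Real.log (2 + L) + (1 + (Real.log R - Real.log (ρ i))) := fun i => by
    have hai : 0 < norm21 ((A i).transpose - (M i).transpose) := by linarith [ha i]
    have h5 := Real.log_le_log (by linarith [hs i]) (hsa i)
    rw [Real.log_mul two_ne_zero hai.ne'] at h5
    exact (log_two_add_mul_le (Nat.cast_nonneg L) (hs i)).trans (by linarith [hloga i])
  have h5 := Finset.sum_le_sum fun i (_ : i ∈ Finset.univ) => h3 i
  have h6 := Finset.sum_le_sum fun i (_ : i ∈ Finset.univ) => h4 i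
  simp only [Finset.sum_add_distrib, Finset.sum_sub_distrib, Finset.sum_const, Finset.card_univ,
    Fintype.card_fin, nsmul_eq_mul, mul_one] at h5 h6
  rw [logConstant, logFactor]
  simp only [Finset.sum_add_distrib, Finset.sum_sub_distrib, Finset.sum_const, Finset.card_univ,
    Fintype.card_fin, nsmul_eq_mul, ← Finset.mul_sum]
  have h7 : 0 ≤ L * (Real.log n + |Real.log γ| + Real.log B) := by positivity
  nlinarith [abs_nonneg (Real.log γ)]

/-- The excess is at most the rate times the logarithmic factor once all quantities are large. -/
lemma excess_le_of_large {ρ : Fin L → NNReal} (hρ : ∀ i, 0 < ρ i) {M A : Weights d m}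
    (hL : 1 ≤ L) (hW : 2 ≤ width d m) {δ : ℝ} (hδ : 0 < δ) (hδ1 : δ < 1)
    {n : ℕ} {γ B : ℝ} (hn : 1 ≤ n) (hγ : 0 < γ) (hB : 1 ≤ B)
    (ha : ∀ i, 1 ≤ norm21 ((A i).transpose - (M i).transpose))
    (hs : ∀ i, 1 ≤ spectralNorm (A i))
    (hsa : ∀ i, spectralNorm (A i) ≤ 2 * norm21 ((A i).transpose - (M i).transpose))
    (hρs : ∀ i, 2 ≤ (ρ i : ℝ) * spectralNorm (A i))
    (hlog1 : 1 ≤ Real.log n) (hlog8 : 8 / Real.sqrt (Real.log (1 / δ)) ≤ Real.log n)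
    (hlogE : 9 / 2 * (|logConstant ρ δ| + (2 + 4 * L)) / Real.log (1 / δ) ≤ Real.log n) :
    excess ρ M δ n γ B A ≤ 1728 * (rate ρ M δ n γ B A * logFactor ρ M n γ B A) := by
  have hn' : (1 : ℝ) ≤ n := by exact_mod_cast hn
  have hn0 : (0 : ℝ) < n := by linarith
  have hW' : (2 : ℝ) ≤ width d m := by exact_mod_cast hW
  have hD : 0 < Real.log (1 / δ) := Real.log_pos (by rw [lt_div_iff₀ hδ]; linarith)
  obtain ⟨hE, hR1⟩ := log_terms_le hρ (δ := δ) hL hn hγ hB ha hs hsa hρs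
  set Λ := logFactor ρ M n γ B A with hΛ
  have hΛn : Real.log n ≤ Λ := by
    have h1 := abs_nonneg (Real.log γ)
    have h2 := Real.log_nonneg hB
    have h3 := Real.log_nonneg hR1
    rw [hΛ, logFactor]
    linarith
  have hΛ1 : 1 ≤ Λ := hlog1.trans hΛn
  set g₁ := B * spectralComplexity ρ M A / (γ * n) * Real.log (width d m) with hg₁
  set g₂ := Real.sqrt (Real.log (1 / δ) / n) with hg₂
  have hg₁0 : 0 ≤ g₁ := by
    have : 0 ≤ Real.log (width d m) := Real.log_nonneg (by linarith)
    positivity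
  have hg₂0 : 0 ≤ g₂ := Real.sqrt_nonneg _
  have hrate : rate ρ M δ n γ B A = g₁ + g₂ := rfl
  have hsn : 1 ≤ Real.sqrt n := Real.one_le_sqrt.2 hn'
  have hg₂eq : g₂ = Real.sqrt (Real.log (1 / δ)) / Real.sqrt n := Real.sqrt_div hD.le _
  have hsD : 0 < Real.sqrt (Real.log (1 / δ)) := Real.sqrt_pos.2 hD
  -- Since `1 / n ≤ 1 / √n`, the statistical term times `Λ` absorbs `8 / n` once `Λ` exceeds a
  -- constant depending on `δ`.
  have hterm1 : 8 / (n : ℝ) ≤ g₂ * Λ := by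
    have h1 : 8 ≤ Real.sqrt (Real.log (1 / δ)) * Λ := by
      have := (div_le_iff₀ hsD).1 (hlog8.trans hΛn)
      linarith
    rw [hg₂eq, div_mul_eq_mul_div]
    refine div_le_div₀ (by positivity) h1 (by positivity) ?_
    rw [Real.sqrt_le_left hn0.le]
    nlinarith
  have hterm2 : 144 * Real.log n * Real.log (2 * width d m) / (γ * n) * (∏ i, (ρ i : ℝ)) *
      (1 + B) * (∑ i, ((1 / (L : ℝ) + norm21 ((A i).transpose - (M i).transpose)) *
      ∏ j ∈ Finset.univ.erase i, (1 / (L : ℝ) + spectralNorm (A j))) ^ (2 / 3 : ℝ)) ^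
        (3 / 2 : ℝ) ≤ 1728 * (g₁ * Λ) := by
    have h1 := complexitySum_shift_le hL ha hs
    have hρ0 : 0 ≤ ∏ i, (ρ i : ℝ) := Finset.prod_nonneg fun i _ => (ρ i).2
    have hlogW : Real.log (2 * width d m) ≤ 2 * Real.log (width d m) := by
      rw [Real.log_mul two_ne_zero (by positivity)]
      have := Real.log_le_log two_pos hW'
      linarith
    have hlogW0 : 0 ≤ Real.log (2 * width d m) := Real.log_nonneg (by linarith)
    have hlw : 0 ≤ Real.log (width d m) := Real.log_nonneg (by linarith)
    have hlogn : 0 ≤ Real.log n := by linarith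
    have hR := spectralComplexity_eq ρ M A
    -- 1728 = 144 · 2 · 2 · 3: the factors come from `log (2 W) ≤ 2 log W`, `1 + B ≤ 2 B`, and the
    -- shifts.
    calc _ ≤ 144 * Real.log n * (2 * Real.log (width d m)) / (γ * n) * (∏ i, (ρ i : ℝ)) *
          (2 * B) * (3 * ((∏ i, spectralNorm (A i)) *
            (∑ i, norm21 ((A i).transpose - (M i).transpose) ^ (2 / 3 : ℝ) /
              spectralNorm (A i) ^ (2 / 3 : ℝ)) ^ (3 / 2 : ℝ))) := by
          refine mul_le_mul ?_ h1 (Real.rpow_nonneg (complexitySum_nonneg (fun i => ?_)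
            fun i => ?_) _) (by positivity)
          · refine mul_le_mul ?_ (by linarith) (by positivity) (by positivity)
            refine mul_le_mul_of_nonneg_right ?_ hρ0
            refine div_le_div_of_nonneg_right ?_ (by positivity)
            exact mul_le_mul_of_nonneg_left hlogW (by positivity)
          · have := norm21_nonneg ((A i).transpose - (M i).transpose)
            positivity
          · have := spectralNorm_nonneg (A i)
            positivity
      _ = 1728 * (g₁ * Real.log n) := by
          rw [hg₁, hR]
          ring
      _ ≤ 1728 * (g₁ * Λ) := by
          have := mul_le_mul_of_nonneg_left hΛn hg₁0
          linarith
  have hterm3 : Real.sqrt (9 / (2 * n)) *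
    Real.sqrt (Real.log (1 / δ) + (Real.log 2 + |Real.log (n / γ)|) + 2 * Real.log (2 + B) +
      2 * ∑ i, Real.log (2 + L * norm21 ((A i).transpose - (M i).transpose)) +
      2 * ∑ i, Real.log (2 + L * spectralNorm (A i))) ≤ g₂ * Λ := by
    rw [← Real.sqrt_mul (by positivity)]
    have e : g₂ * Λ = Real.sqrt (Real.log (1 / δ) / n * Λ ^ 2) := by
      rw [Real.sqrt_mul (by positivity), Real.sqrt_sq (by linarith)]
    rw [e]
    refine Real.sqrt_le_sqrt ?_
    -- The logarithmic terms are at most a fixed multiple of `Λ`. The second factor `Λ` in `Λ ^ 2`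
    -- under the root absorbs that multiple, so it does not enter the universal constant.
    have h1 : 9 / 2 * (|logConstant ρ δ| + (2 + 4 * L)) ≤ Λ * Real.log (1 / δ) :=
      (div_le_iff₀ hD).1 (hlogE.trans hΛn)
    have h2 : logConstant ρ δ + (2 + 4 * L) * Λ ≤ (|logConstant ρ δ| + (2 + 4 * L)) * Λ := by
      have h3 := le_abs_self (logConstant ρ δ)
      have h4 := le_mul_of_one_le_right (abs_nonneg (logConstant ρ δ)) hΛ1
      linarith
    have h3 := mul_le_mul_of_nonneg_right h1 (by linarith : 0 ≤ Λ)
    calc _ ≤ 9 / (2 * (n : ℝ)) * ((|logConstant ρ δ| + (2 + 4 * L)) * Λ) :=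
          mul_le_mul_of_nonneg_left (hE.trans h2) (by positivity)
      _ = (9 / 2 * (|logConstant ρ δ| + (2 + 4 * L)) * Λ) / n := by
          field_simp
      _ ≤ (Λ * Real.log (1 / δ) * Λ) / n := div_le_div_of_nonneg_right h3 hn0.le
      _ = _ := by ring
  have hg₂Λ : 0 ≤ g₂ * Λ := by positivity
  rw [hrate, excess]
  linarith

/-- The excess is eventually bounded by the rate times the logarithmic factor. -/
lemma eventually_excess_le {ρ : Fin L → NNReal} (hρ : ∀ i, 0 < ρ i) (M : Weights d m)
    (hL : 1 ≤ L) (hW : 2 ≤ width d m) {δ : ℝ} (hδ : 0 < δ) (hδ1 : δ < 1)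
    {n : ℕ → ℕ} {γ B : ℕ → ℝ} {A : ℕ → Weights d m} (hγ : ∀ t, 0 < γ t)
    (hn : Tendsto n atTop atTop) (hB : Tendsto B atTop atTop)
    (hA : ∀ i, Tendsto (fun t => spectralNorm (A t i)) atTop atTop) :
    ∀ᶠ t in atTop, excess ρ M δ (n t) (γ t) (B t) (A t) ≤
      1728 * (rate ρ M δ (n t) (γ t) (B t) (A t) * logFactor ρ M (n t) (γ t) (B t) (A t)) := by
  have hlog : Tendsto (fun t => Real.log (n t)) atTop atTop :=
    Real.tendsto_log_atTop.comp (tendsto_natCast_atTop_atTop.comp hn)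
  have hlarge : ∀ᶠ t in atTop, ∀ i, 1 ≤ norm21 ((A t i).transpose - (M i).transpose) ∧
      1 ≤ spectralNorm (A t i) ∧
      spectralNorm (A t i) ≤ 2 * norm21 ((A t i).transpose - (M i).transpose) ∧
      2 ≤ (ρ i : ℝ) * spectralNorm (A t i) := by
    rw [eventually_all]
    intro i
    have hρi : (0 : ℝ) < ρ i := hρ i
    -- The distance is at least the spectral norm minus that of `M i`; these thresholds make it at
    -- least 1 and at least half the spectral norm.
    filter_upwards [(hA i).eventually_ge_atTop (1 + 2 * spectralNorm (M i)),
      (hA i).eventually_ge_atTop 2, (hA i).eventually_ge_atTop (1 + spectralNorm (M i)),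
      (hA i).eventually_ge_atTop (2 / ρ i)] with t h1 h2 h3 h4
    have h5 := spectralNorm_sub_le (A t i) (M i)
    have h6 := (div_le_iff₀ hρi).1 h4
    exact ⟨by linarith, by linarith, by linarith, by linarith⟩
  filter_upwards [hlarge, hn.eventually_ge_atTop 1, hB.eventually_ge_atTop 1,
    hlog.eventually_ge_atTop 1,
    hlog.eventually_ge_atTop (8 / Real.sqrt (Real.log (1 / δ))),
    hlog.eventually_ge_atTop (9 / 2 * (|logConstant ρ δ| + (2 + 4 * L)) / Real.log (1 / δ))]
    with t h1 h2 h3 h4 h5 h6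
  exact excess_le_of_large hρ hL hW hδ hδ1 h2 (hγ t) h3 (fun i => (h1 i).1)
    (fun i => (h1 i).2.1) (fun i => (h1 i).2.2.1) (fun i => (h1 i).2.2.2) h4 h5 h6

end Rate

end SpectralMargin

theorem mainTheorem1 :
    ∃ C : ℝ, 0 < C ∧
      ∀ (L : ℕ) (_ : 1 ≤ L) (d : Fin (L + 1) → ℕ) (m : Fin L → ℕ)
        (_ : 2 ≤ d (Fin.last L))
        (σ : SpectralMargin.Nonlinearities d m) (ρ : Fin L → NNReal)
        (_ : ∀ i, LipschitzWith (ρ i) (σ i)) (_ : ∀ i, σ i 0 = 0)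
        (M : SpectralMargin.Weights d m) (δ : ℝ) (_ : 0 < δ) (_ : δ < 1),
        -- the bound: outside an event of probability at most `δ`, all `γ` and `A` satisfy it
        (∀ (μ : Measure (EuclideanSpace ℝ (Fin (d 0)) × Fin (d (Fin.last L))))
            [IsProbabilityMeasure μ] (n : ℕ) (_ : 1 ≤ n),
          (Measure.pi fun _ : Fin n => μ)
            {S | ¬ ∀ (γ : ℝ) (_ : 0 < γ) (A : SpectralMargin.Weights d m)
                -- `c` is the predicted label, with any rule for breaking ties
                (c : EuclideanSpace ℝ (Fin (d 0)) → Fin (d (Fin.last L)))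
                (_ : ∀ x j, SpectralMargin.network σ A x j ≤ SpectralMargin.network σ A x (c x)),
                μ.real {z | c z.1 ≠ z.2} ≤
                  SpectralMargin.empiricalRampRisk γ (SpectralMargin.network σ A) S +
                  SpectralMargin.excess ρ M δ n γ
                    (SpectralMargin.dataNorm fun i => (S i).1) A}
            ≤ ENNReal.ofReal δ) ∧
        -- the empirical ramp risk is at most the empirical margin error
        (∀ (n : ℕ) (S : Fin n → EuclideanSpace ℝ (Fin (d 0)) × Fin (d (Fin.last L)))
            (γ : ℝ) (_ : 0 < γ) (A : SpectralMargin.Weights d m),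
          SpectralMargin.empiricalRampRisk γ (SpectralMargin.network σ A) S ≤
            SpectralMargin.empiricalMarginError γ (SpectralMargin.network σ A) S) ∧
        -- the excess is the stated rate up to a logarithmic factor
        ((∀ i, 0 < ρ i) →
          ∀ (n : ℕ → ℕ) (γ : ℕ → ℝ) (X : ∀ t, Fin (n t) → EuclideanSpace ℝ (Fin (d 0)))
            (A : ℕ → SpectralMargin.Weights d m),
            (∀ t, 0 < γ t) →
            Tendsto n atTop atTop →
            Tendsto (fun t => SpectralMargin.dataNorm (X t)) atTop atTop →
            (∀ i, Tendsto (fun t => SpectralMargin.spectralNorm (A t i)) atTop atTop) →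
            ∀ᶠ t in atTop,
              SpectralMargin.excess ρ M δ (n t) (γ t) (SpectralMargin.dataNorm (X t)) (A t) ≤
                C * (SpectralMargin.rate ρ M δ (n t) (γ t)
                    (SpectralMargin.dataNorm (X t)) (A t) *
                  SpectralMargin.logFactor ρ M (n t) (γ t)
                    (SpectralMargin.dataNorm (X t)) (A t))) := by
  refine ⟨1728, by norm_num, fun L hL d m hk σ ρ hσ hσ0 M δ hδ hδ1 => ⟨?_, ?_, ?_⟩⟩
  · intro μ _ n hn
    exact SpectralMargin.generalization_bound hL hk hσ hσ0 M hδ hδ1 μ hn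
  · intro n S γ hγ A
    exact SpectralMargin.empiricalRampRisk_le_empiricalMarginError hγ _ S
  · intro hρ n γ X A hγ hn hX hA
    exact SpectralMargin.eventually_excess_le hρ M hL
      (hk.trans (SpectralMargin.layer_le_width_left _)) hδ hδ1 hγ hn hX hA
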